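/- Let $f(r)=(2\pi)^{-3/2}e^{-r^2/2}$ and let $d\mu(z)=f(|z|)\,dm(z)$ be the standard Gaussian measure on the space $\Lambda\cong\mathbb{R}^3$ of pure (imaginary) quaternions. For quaternionic polynomials $p(z)=\sum_k z^k a_k$ put $\langle p,q\rangle=\int_\Lambda \overline{p(z)}\,q(z)\,d\mu(z)$. Let $P_n$ be the monic orthogonal polynomials for this scalar product (obtained from $1,z,z^2,\dots$ by the Gram--Schmidt process), let $h_n=\langle P_n,P_n\rangle$, and let $Q_n$ be the real polynomial determined by $P_n(us)=u^nQ_n(s)$ for all $s\in\mathbb{R}$ and all pure unit quaternions $u$. For real $s\neq t$ let $$\rho_n(s,t)=\frac{Q_n(s)Q_{n+1}(t)-Q_{n+1}(s)Q_n(t)}{h_n\,(t-s)},$$ and let $\rho_n(s,s)=\frac{1}{h_n}\big[Q_n(s)Q_{n+1}'(s)-Q_{n+1}(s)Q_n'(s)\big]$ be the continuous extension to the diagonal. Finally let $$\rho(s)=\frac{1}{(2\pi)^2}\frac{\sqrt{1-s^2}}{s^2}\qquad (0<s<1).$$ **Theorem.** For every $\varepsilon>0$ and every $M$ there is a constant $C$,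 depending only on $\varepsilon$ and $M$, such that the following holds for all integers $n\ge 1$, all $x_0\in[\varepsilon,1-\varepsilon]$ and all real $\sigma,\tau$ with $|\sigma|,|\tau|\le M$. Put $\phi=\arccos x_0$ and $$s_n=2\sqrt{n+\tfrac32}\,\cos\Big(\phi+\frac{\sigma}{2\sin^2\phi}\frac1n\Big),\qquad t_n=2\sqrt{n+\tfrac32}\,\cos\Big(\phi+\frac{\tau}{2\sin^2\phi}\frac1n\Big).$$ Then $$\Big|\,2\sqrt{n+\tfrac32}\;\rho_n(s_n,t_n)\sqrt{f(s_n)f(t_n)}-\frac{\sin(\tau-\sigma)}{\tau-\sigma}\,\rho(x_0)\Big|\le C\,n^{-1/2},$$ where $\frac{\sin(\tau-\sigma)}{\tau-\sigma}$ is read as $1$ when $\tau=\sigma$. -/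

import Mathlib

open scoped Quaternion

namespace QuatField

noncomputable section

/-- The density of the background measure `dμ(z) = f(|z|) dm(z)` on the space of pure quaternions
`ℝ³`, as a function of the radius. -/
def f (r : ℝ) : ℝ := (2 * Real.pi) ^ (-(3 / 2) : ℝ) * Real.exp (-r ^ 2 / 2)

/-- The pure (imaginary) quaternion `z₁ i + z₂ j + z₃ k` with coordinates `z ∈ ℝ³`. -/
def pureQ (z : EuclideanSpace ℝ (Fin 3)) : ℍ[ℝ] := ⟨0, z 0, z 1, z 2⟩

theorem pureQ_re (z : EuclideanSpace ℝ (Fin 3)) : (pureQ z).re = 0 := rfl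

theorem pureQ_neg (z : EuclideanSpace ℝ (Fin 3)) : pureQ (-z) = -pureQ z := by
  ext
  · exact neg_zero.symm
  all_goals rfl

/-- Pure quaternions of norm one. -/
def IsUnitPure (u : ℍ[ℝ]) : Prop := u.re = 0 ∧ ‖u‖ = 1

/-- The value `∑ zᵏ aₖ` at `z` of a quaternionic polynomial with coefficients written on the
right. -/
def rightEval (p : Polynomial ℍ[ℝ]) (z : ℍ[ℝ]) : ℍ[ℝ] := p.sum fun k a => z ^ k * a

/-- The quaternion-valued scalar product `⟨p, q⟩ = ∫ conj (p(z)) q(z) dμ(z)` over the space of pure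
quaternions. -/
def scalarProd (p q : Polynomial ℍ[ℝ]) : ℍ[ℝ] :=
  ∫ z : EuclideanSpace ℝ (Fin 3),
    f ‖z‖ • (star (rightEval p (pureQ z)) * rightEval q (pureQ z))

/-- The monic orthogonal polynomials for `scalarProd`, by Gram-Schmidt orthogonalization of the
monomials `1, z, z², …`. -/
def P (n : ℕ) : Polynomial ℍ[ℝ] :=
  Polynomial.X ^ n - ∑ k : Fin n,
    P k * Polynomial.C ((scalarProd (P k) (P k))⁻¹ * scalarProd (P k) (Polynomial.X ^ n))
termination_by n
decreasing_by exact k.isLt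

/-- The squared norm `h_n = ⟨P_n, P_n⟩` (a real number). -/
def h (n : ℕ) : ℝ := (scalarProd (P n) (P n)).re

theorem P_eq (n : ℕ) : P n = Polynomial.X ^ n - ∑ k : Fin n,
    P k * Polynomial.C ((scalarProd (P k) (P k))⁻¹ * scalarProd (P k) (Polynomial.X ^ n)) := by
  rw [P]

theorem rightEval_add (p q : Polynomial ℍ[ℝ]) (z : ℍ[ℝ]) :
    rightEval (p + q) z = rightEval p z + rightEval q z :=
  Polynomial.sum_add_index p q _ (by simp) (by intros; simp [mul_add])

theorem rightEval_X_pow (n : ℕ) (z : ℍ[ℝ]) : rightEval (Polynomial.X ^ n) z = z ^ n := by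
  rw [rightEval, Polynomial.X_pow_eq_monomial, Polynomial.sum_monomial_index] <;> simp

theorem rightEval_mul_C (p : Polynomial ℍ[ℝ]) (a z : ℍ[ℝ]) :
    rightEval (p * Polynomial.C a) z = rightEval p z * a := by
  induction p using Polynomial.induction_on' with
  | add p q hp hq => rw [add_mul, rightEval_add, rightEval_add, hp, hq, add_mul]
  | monomial n b =>
    rw [Polynomial.monomial_mul_C, rightEval, rightEval, Polynomial.sum_monomial_index,
      Polynomial.sum_monomial_index, mul_assoc] <;> simp

/-- Evaluation at `z` as an additive map. -/
def rightEvalHom (z : ℍ[ℝ]) : Polynomial ℍ[ℝ] →+ ℍ[ℝ] :=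
  AddMonoidHom.mk' (fun p => rightEval p z) fun p q => rightEval_add p q z

theorem rightEval_P (n : ℕ) (z : ℍ[ℝ]) : rightEval (P n) z = z ^ n - ∑ k : Fin n,
    rightEval (P k) z *
      ((scalarProd (P k) (P k))⁻¹ * scalarProd (P k) (Polynomial.X ^ n)) := by
  have h1 : rightEval (P n) z = rightEvalHom z (P n) := rfl
  rw [h1, P_eq, map_sub, map_sum]
  congr 1
  · exact rightEval_X_pow n z
  · exact Finset.sum_congr rfl fun k _ => rightEval_mul_C _ _ _

theorem IsUnitPure.mul_self {u : ℍ[ℝ]} (hu : IsUnitPure u) : u * u = -1 := by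
  have h1 : star u = -u := by
    ext <;> simp [hu.1]
  have h2 : u * star u = 1 := by
    rw [Quaternion.self_mul_star, Quaternion.normSq_eq_norm_mul_self, hu.2]; simp
  rw [h1] at h2
  rw [← h2]; simp

theorem IsUnitPure.star_eq {u : ℍ[ℝ]} (hu : IsUnitPure u) : star u = -u := by
  ext <;> simp [hu.1]

theorem IsUnitPure.neg {u : ℍ[ℝ]} (hu : IsUnitPure u) : IsUnitPure (-u) :=
  ⟨by simp [hu.1], by rw [norm_neg, hu.2]⟩

theorem IsUnitPure.pow_even {u : ℍ[ℝ]} (hu : IsUnitPure u) (j : ℕ) :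
    u ^ (2 * j) = (((-1 : ℝ) ^ j : ℝ) : ℍ[ℝ]) := by
  rw [pow_mul, pow_two, hu.mul_self]; push_cast; rfl

theorem exists_polar (z : EuclideanSpace ℝ (Fin 3)) :
    ∃ (u : ℍ[ℝ]) (s : ℝ), IsUnitPure u ∧ pureQ z = u * (s : ℍ[ℝ]) := by
  by_cases hz : pureQ z = 0
  · refine ⟨pureQ !₂[1, 0, 0], 0, ⟨rfl, ?_⟩, by rw [hz, Quaternion.coe_zero, mul_zero]⟩
    have h1 := Quaternion.normSq_eq_norm_mul_self (pureQ !₂[1, 0, 0])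
    rw [Quaternion.normSq_def'] at h1
    have h3 : (1 : ℝ) = ‖pureQ !₂[1, 0, 0]‖ * ‖pureQ !₂[1, 0, 0]‖ := by
      rw [← h1]; simp [pureQ]
    rcases mul_self_eq_one_iff.1 h3.symm with h2 | h2
    · exact h2
    · have := norm_nonneg (pureQ !₂[1, 0, 0])
      linarith
  · have hn : ‖pureQ z‖ ≠ 0 := norm_ne_zero_iff.2 hz
    refine ⟨pureQ z * ((‖pureQ z‖⁻¹ : ℝ) : ℍ[ℝ]), ‖pureQ z‖, ⟨?_, ?_⟩, ?_⟩
    · rw [Quaternion.re_mul, pureQ_re, Quaternion.imI_coe, Quaternion.imJ_coe, Quaternion.imK_coe]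
      ring
    · rw [norm_mul, Quaternion.norm_coe, norm_inv, norm_norm, mul_inv_cancel₀ hn]
    · rw [mul_assoc, ← Quaternion.coe_mul, inv_mul_cancel₀ hn]; simp

/-- The inclusion of the reals into the quaternions. -/
def coeIsom : ℝ →ₗᵢ[ℝ] ℍ[ℝ] where
  toFun r := (r : ℍ[ℝ])
  map_add' := by intros; simp
  map_smul' := by intros; ext <;> simp
  norm_map' r := Quaternion.norm_coe r

theorem integral_real {F : EuclideanSpace ℝ (Fin 3) → ℍ[ℝ]} (hF : ∀ z, ∃ r : ℝ, F z = (r : ℍ[ℝ])) :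
    ∃ r : ℝ, ∫ z, F z = (r : ℍ[ℝ]) := by
  choose g hg using hF
  refine ⟨∫ z, g z, ?_⟩
  have := coeIsom.integral_comp_comm (μ := MeasureTheory.volume) g
  rw [funext hg]
  exact this

theorem integral_odd {F : EuclideanSpace ℝ (Fin 3) → ℍ[ℝ]} (hF : ∀ z, F (-z) = -F z) :
    ∫ z, F z = 0 := by
  have h1 := MeasureTheory.integral_neg_eq_self F MeasureTheory.volume
  rw [funext hF, MeasureTheory.integral_neg] at h1
  have h2 : (2 : ℝ) • ∫ z, F z = 0 := by
    rw [two_smul]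
    nth_rewrite 1 [← h1]
    simp
  exact (smul_eq_zero.1 h2).resolve_left two_ne_zero

/-- `P_n(us) = uⁿ Q_n(s)` for a real polynomial `Q_n`. -/
theorem exists_Q (n : ℕ) : ∃ Q : Polynomial ℝ, ∀ (u : ℍ[ℝ]) (s : ℝ), IsUnitPure u →
    rightEval (P n) (u * (s : ℍ[ℝ])) = u ^ n * ((Q.eval s : ℝ) : ℍ[ℝ]) := by
  induction n using Nat.strong_induction_on with
  | _ n ih =>
  have key : ∀ (k m : ℕ) (Q p : Polynomial ℝ) (A B : Polynomial ℍ[ℝ]),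
      (∀ (u : ℍ[ℝ]) (s : ℝ), IsUnitPure u →
        rightEval A (u * (s : ℍ[ℝ])) = u ^ k * ((Q.eval s : ℝ) : ℍ[ℝ])) →
      (∀ (u : ℍ[ℝ]) (s : ℝ), IsUnitPure u →
        rightEval B (u * (s : ℍ[ℝ])) = u ^ m * ((p.eval s : ℝ) : ℍ[ℝ])) →
      (∃ r : ℝ, scalarProd A B = (r : ℍ[ℝ])) ∧
        (Odd (k + m) → scalarProd A B = 0) := by
    intro k m Q p A B hA hB
    have hval : ∀ (u : ℍ[ℝ]) (s : ℝ), IsUnitPure u →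
        star (rightEval A (u * (s : ℍ[ℝ]))) * rightEval B (u * (s : ℍ[ℝ])) =
          u ^ (k + m) * (((-1) ^ k * Q.eval s * p.eval s : ℝ) : ℍ[ℝ]) := by
      intro u s hu
      rw [hA u s hu, hB u s hu, star_mul, star_pow, hu.star_eq, Quaternion.star_coe, neg_pow,
        (Quaternion.coe_commutes (Q.eval s) _), pow_add]
      push_cast
      have hc1 : Commute ((Q.eval s : ℝ) : ℍ[ℝ]) (u ^ m) := Quaternion.coe_commute _ _
      have hc2 : Commute ((-1 : ℍ[ℝ]) ^ k) (u ^ k * u ^ m) := (Commute.neg_one_left _).pow_left k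
      calc (-1) ^ k * u ^ k * ((Q.eval s : ℝ) : ℍ[ℝ]) * (u ^ m * ((p.eval s : ℝ) : ℍ[ℝ]))
          = (-1) ^ k * u ^ k * (((Q.eval s : ℝ) : ℍ[ℝ]) * u ^ m) * ((p.eval s : ℝ) : ℍ[ℝ]) := by
            simp only [mul_assoc]
        _ = (-1) ^ k * (u ^ k * u ^ m) * (((Q.eval s : ℝ) : ℍ[ℝ]) * ((p.eval s : ℝ) : ℍ[ℝ])) := by
            rw [hc1.eq]; simp only [mul_assoc]
        _ = _ := by rw [hc2.eq]; simp only [mul_assoc]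
    have hodd : Odd (k + m) → scalarProd A B = 0 := by
      intro ho
      refine integral_odd fun z => ?_
      obtain ⟨u, s, hu, hz⟩ := exists_polar z
      have hz' : pureQ (-z) = (-u) * (s : ℍ[ℝ]) := by
        rw [neg_mul, ← hz, pureQ_neg]
      rw [norm_neg, hz', hz, hval u s hu, hval (-u) s hu.neg, ho.neg_pow, neg_mul, smul_neg]
    refine ⟨?_, hodd⟩
    rcases Nat.even_or_odd (k + m) with he | ho
    · refine integral_real fun z => ?_
      obtain ⟨u, s, hu, hz⟩ := exists_polar z
      obtain ⟨j, hj⟩ := he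
      refine ⟨f ‖z‖ * ((-1) ^ j * ((-1) ^ k * Q.eval s * p.eval s)), ?_⟩
      rw [hz, hval u s hu, hj, ← two_mul, hu.pow_even, ← Quaternion.coe_mul,
        ← Quaternion.coe_mul_eq_smul, ← Quaternion.coe_mul]
    · exact ⟨0, by rw [hodd ho]; simp⟩
  have hX : ∀ (u : ℍ[ℝ]) (s : ℝ), IsUnitPure u →
      rightEval (Polynomial.X ^ n) (u * (s : ℍ[ℝ])) =
        u ^ n * ((((Polynomial.X : Polynomial ℝ) ^ n).eval s : ℝ) : ℍ[ℝ]) := by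
    intro u s _
    rw [rightEval_X_pow,
      (show Commute u (s : ℍ[ℝ]) from (Quaternion.coe_commutes s u).symm).mul_pow]
    simp
  have hterm : ∀ k : Fin n, ∃ R : Polynomial ℝ, ∀ (u : ℍ[ℝ]) (s : ℝ), IsUnitPure u →
      rightEval (P k) (u * (s : ℍ[ℝ])) *
        ((scalarProd (P k) (P k))⁻¹ * scalarProd (P k) (Polynomial.X ^ n)) =
          u ^ n * ((R.eval s : ℝ) : ℍ[ℝ]) := by
    intro k
    obtain ⟨Q, hQ⟩ := ih k k.isLt
    obtain ⟨⟨r, hr⟩, hodd⟩ := key k n Q _ _ _ hQ hX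
    obtain ⟨⟨t, ht⟩, -⟩ := key k k Q Q _ _ hQ hQ
    rcases Nat.even_or_odd (k + n) with he | ho
    · obtain ⟨j, hj⟩ : ∃ j, n = k + 2 * j := by
        obtain ⟨a, ha⟩ := he
        exact ⟨a - k, by have := k.isLt; omega⟩
      refine ⟨Polynomial.C ((-1) ^ j * (t⁻¹ * r)) * Q, fun u s hu => ?_⟩
      have hs : ((-1 : ℝ) ^ j) * (-1) ^ j = 1 := by
        rw [← mul_pow]; simp
      have h3 : u ^ n = u ^ (k : ℕ) * (((-1 : ℝ) ^ j : ℝ) : ℍ[ℝ]) := by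
        conv_lhs => rw [hj]
        rw [pow_add, hu.pow_even]
      rw [hQ u s hu, ht, hr, h3, ← Quaternion.coe_inv, ← Quaternion.coe_mul, mul_assoc, mul_assoc,
        ← Quaternion.coe_mul, ← Quaternion.coe_mul]
      congr 2
      rw [Polynomial.eval_mul, Polynomial.eval_C]
      linear_combination (-(t⁻¹ * r * Q.eval s)) * hs
    · exact ⟨0, fun u s hu => by rw [hodd ho]; simp⟩
  choose R hR using hterm
  refine ⟨Polynomial.X ^ n - ∑ k, R k, fun u s hu => ?_⟩
  have hsum : (((∑ k, R k).eval s : ℝ) : ℍ[ℝ]) = ∑ k, (((R k).eval s : ℝ) : ℍ[ℝ]) := by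
    rw [Polynomial.eval_finsetSum]
    exact map_sum coeIsom.toLinearMap _ _
  rw [rightEval_P, Polynomial.eval_sub, Quaternion.coe_sub, mul_sub, hsum, Finset.mul_sum,
    ← hX u s hu, rightEval_X_pow]
  congr 1
  exact Finset.sum_congr rfl fun k _ => hR k u s hu

/-- The real polynomial determined by `P_n(us) = uⁿ Q_n(s)` for all real `s` and all unit pure
quaternions `u`. -/
def Q (n : ℕ) : Polynomial ℝ := (exists_Q n).choose

/-- The function `ρ_n(s, t)`, extended to the diagonal by its limit as `t → s`. -/
def rhoN (n : ℕ) (s t : ℝ) : ℝ :=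
  if s = t then
    ((Q n).eval s * (Polynomial.derivative (Q (n + 1))).eval s
      - (Q (n + 1)).eval s * (Polynomial.derivative (Q n)).eval s) / h n
  else
    ((Q n).eval s * (Q (n + 1)).eval t - (Q (n + 1)).eval s * (Q n).eval t) / (h n * (t - s))

/-- The limiting density. -/
def rho (s : ℝ) : ℝ := 1 / (2 * Real.pi) ^ 2 * (√(1 - s ^ 2) / s ^ 2)

/-- The rescaled point `2 √(n + 3/2) cos (φ + σ / (2 n sin² φ))` with `φ = arccos x₀`; it is `s_n`
for the parameter `σ`, and `t_n` for the parameter `τ`. -/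
def rescaledPoint (x₀ σ : ℝ) (n : ℕ) : ℝ :=
  2 * √((n : ℝ) + 3 / 2) *
    Real.cos (Real.arccos x₀ + σ / (2 * Real.sin (Real.arccos x₀) ^ 2) * (1 / (n : ℝ)))

end

end QuatField

/-! ### Generalized Hermite polynomials and their relation to Hermite polynomials. -/

namespace QuatField
noncomputable section

open Polynomial MeasureTheory

/-! In polar form $z=us$ the quaternionic scalar product becomes, up to a sign, integration over the
line against $s^2e^{-s^2/2}$; products of opposite parity integrate to zero by oddness. Hence
Gram–Schmidt reproduces the generalized Hermite polynomials for that weight (`hasPolarForm_P`), and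
these are Hermite polynomials in disguise: $sQ_{2m}$ is $He_{2m+1}$, and $s^2Q_{2m+1}$ is a
combination of two Hermite polynomials (`genHe_hermite`). Writing everything through the single
index $N=n+1$ turns the kernel into $1/(st)$ times the Wronskian quotient of the Hermite function of
index $N$, plus lower order terms (`rhoN_eq_wronskian`). Since $N+\frac12=n+\frac32$, the scale in
the theorem is exactly the turning point scale of that function.

Only the amplitude and phase differences of the Hermite function are needed, so no Plancherel–Rotach
formula enters. With $s=2\sqrt{N+1/2}\cos\theta$ and $L=2N+1$, the oscillator equation becomes
$Y'=-L\sin\theta\,Z$, $Z'=L\sin^3\theta\,Y$. The quantity $Z^2/\sin\theta+\sin\theta\,Y^2$ is an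
adiabatic invariant, constant up to a relative error $O(1/L)$ away from the turning point
(`angEnergy_sub_le`). Its value at $\theta=\pi/2$, that is at $s=0$, is a central binomial quantity,
which Wallis' product shows to be asymptotic to $\sqrt{2/\pi}/\sqrt{N+1/2}$ (`adiabatic_bound`).

The two points lie at angles within $O(1/n)$ of $\phi$. There $\sin\theta$ may be frozen at
$c=\sin\phi$, and $(cY,Z)$ rotates with frequency $Lc^2$. This expresses the Wronskian as minus the
squared amplitude times the sine of $Lc^2$ times the angle difference, which is $\tau-\sigma$ up to
$O(1/n)$ (`abs_wronskian_add_le`). Multiplying the limits of all factors gives the sine kernel with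
error $O(1/n)$, uniformly for $\sigma\ne\tau$ and large $n$ (`scaledKernel_sub_isBigO`). The
diagonal follows by continuity, and the finitely many remaining $n$ by a crude bound. -/

/-- The probabilists' Hermite polynomials over the reals. -/
def He (n : ℕ) : ℝ[X] := (hermite n).map (Int.castRingHom ℝ)

theorem He_zero : He 0 = 1 := by simp [He]

theorem He_one : He 1 = X := by simp [He]

theorem He_succ (n : ℕ) : He (n + 1) = X * He n - derivative (He n) := by
  simp [He, hermite_succ, derivative_map]

theorem He_monic (n : ℕ) : (He n).Monic := (hermite_monic n).map _

theorem natDegree_He (n : ℕ) : (He n).natDegree = n := by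
  rw [He, (hermite_monic n).natDegree_map, natDegree_hermite]

theorem derivative_He_succ (n : ℕ) : derivative (He (n + 1)) = (n + 1 : ℝ[X]) * He n := by
  induction n with
  | zero => simp [He_zero, He_one]
  | succ n ih =>
    have h1 : derivative (derivative (He (n + 1))) = (n + 1 : ℝ[X]) * derivative (He n) := by
      rw [ih, derivative_mul]; simp
    rw [He_succ (n + 1), derivative_sub, derivative_mul, derivative_X, h1, ih, He_succ n]
    push_cast
    ring

theorem He_add_two (n : ℕ) : He (n + 2) = X * He (n + 1) - (n + 1 : ℝ[X]) * He n := by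
  rw [He_succ (n + 1), derivative_He_succ]

/-- Recurrence coefficients of the generalized Hermite polynomials for the weight
`s² exp (-s² / 2)`. -/
def genCoeff (n : ℕ) : ℝ := if Even n then n else n + 2

/-- Generalized Hermite polynomials: monic orthogonal polynomials for the weight
`s² exp (-s² / 2)`. -/
def genHe : ℕ → ℝ[X]
  | 0 => 1
  | 1 => X
  | n + 2 => X * genHe (n + 1) - C (genCoeff (n + 1)) * genHe n

/-- Orthogonality for $s^2e^{-s^2/2}$ against even polynomials is, after one factor $s$ goes to each
side, Gaussian orthogonality against odd ones; hence the first identity. The two identities feed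
each other through the three-term recurrences, so they are proved in one induction. -/
theorem genHe_hermite (m : ℕ) : X * genHe (2 * m) = He (2 * m + 1) ∧
    X ^ 2 * genHe (2 * m + 1) = X * He (2 * m + 2) + He (2 * m + 1) := by
  induction m with
  | zero =>
    refine ⟨by simp [genHe, He_one], ?_⟩
    have := He_add_two 0
    simp only [zero_add, He_one, He_zero, Nat.cast_zero] at this
    simp only [mul_zero, zero_add, genHe, this, He_one]
    ring
  | succ m ih =>
    obtain ⟨h1, h2⟩ := ih
    have e1 : genHe (2 * (m + 1)) =
        X * genHe (2 * m + 1) - (2 * m + 3 : ℝ[X]) * genHe (2 * m) := by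
      have : genCoeff (2 * m + 1) = 2 * m + 3 := by
        rw [genCoeff, if_neg (by simp)]; push_cast; ring
      rw [show 2 * (m + 1) = 2 * m + 2 by ring, genHe, this]
      simp only [map_add, map_mul, map_natCast, map_ofNat]
    have e2 : genHe (2 * (m + 1) + 1) =
        X * genHe (2 * (m + 1)) - (2 * m + 2 : ℝ[X]) * genHe (2 * m + 1) := by
      have : genCoeff (2 * m + 2) = 2 * m + 2 := by
        rw [genCoeff, if_pos (by simp [parity_simps])]; push_cast; ring
      rw [show 2 * (m + 1) + 1 = 2 * m + 1 + 2 by ring, genHe, this]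
      simp only [map_add, map_mul, map_natCast, map_ofNat, show 2 * (m + 1) = 2 * m + 1 + 1 by ring]
    have r1 := He_add_two (2 * m + 1)
    have r2 := He_add_two (2 * m + 2)
    simp only [add_assoc, Nat.reduceAdd] at r1 r2
    push_cast at r1 r2
    have f1 : X * genHe (2 * (m + 1)) = He (2 * m + 3) := by
      rw [e1, r1]
      linear_combination h2 - (2 * m + 3 : ℝ[X]) * h1
    refine ⟨by rw [f1]; rfl, ?_⟩
    rw [e2, show 2 * (m + 1) + 2 = 2 * m + 4 by ring, show 2 * (m + 1) + 1 = 2 * m + 3 by ring]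
    have r3 : X ^ 2 * He (2 * m + 3) =
        X * He (2 * m + 4) + (2 * m + 3 : ℝ[X]) * (X * He (2 * m + 2)) := by
      rw [r2]; ring
    have : He (2 * m + 3) = X * He (2 * m + 2) - (2 * m + 2 : ℝ[X]) * He (2 * m + 1) := by
      rw [r1]; ring
    linear_combination X ^ 2 * f1 - (2 * m + 2 : ℝ[X]) * h2 + r3 - this

theorem X_sq_mul_genHe_even (m : ℕ) : X ^ 2 * genHe (2 * m) = He (2 * m + 1) * X := by
  rw [← (genHe_hermite m).1]; ring

/-- Only Hermite indices at least $2m+1$ occur on the right, so orthogonality to lower degrees and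
the norm can be read off directly. -/
theorem X_sq_mul_genHe_odd (m : ℕ) : X ^ 2 * genHe (2 * m + 1) =
    He (2 * m + 3) + (2 * m + 3 : ℝ[X]) * He (2 * m + 1) := by
  rw [(genHe_hermite m).2, He_add_two (2 * m + 1)]
  push_cast
  ring

theorem genHe_degree (n : ℕ) : (genHe n).Monic ∧ (genHe n).natDegree = n := by
  rcases n.even_or_odd' with ⟨m, rfl | rfl⟩
  · have h1 := (genHe_hermite m).1
    have hm : (genHe (2 * m)).Monic := by
      have := He_monic (2 * m + 1)
      rw [← h1, Monic, leadingCoeff_mul, leadingCoeff_X, one_mul] at this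
      exact this
    refine ⟨hm, ?_⟩
    have := natDegree_He (2 * m + 1)
    rw [← h1, natDegree_X_mul hm.ne_zero] at this
    omega
  · have h1 := X_sq_mul_genHe_odd m
    have hd : ((2 * m + 3 : ℝ[X]) * He (2 * m + 1)).degree < (He (2 * m + 3)).degree := by
      have : (2 * m + 3 : ℝ[X]) = C (2 * m + 3 : ℝ) := by
        simp only [map_add, map_mul, map_natCast, map_ofNat]
      rw [this, degree_C_mul (by positivity), degree_eq_natDegree (He_monic _).ne_zero,
        degree_eq_natDegree (He_monic _).ne_zero, natDegree_He, natDegree_He]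
      exact_mod_cast (by omega : 2 * m + 1 < 2 * m + 3)
    have hs : (X ^ 2 * genHe (2 * m + 1)).Monic := by
      rw [h1]; exact (He_monic _).add_of_left hd
    have hn : (X ^ 2 * genHe (2 * m + 1)).natDegree = 2 * m + 3 := by
      rw [h1, natDegree_add_eq_left_of_degree_lt hd, natDegree_He]
    have hm : (genHe (2 * m + 1)).Monic := (monic_X_pow 2).of_mul_monic_left hs
    refine ⟨hm, ?_⟩
    rw [(monic_X_pow 2).natDegree_mul hm, natDegree_X_pow] at hn
    omega

theorem genHe_eval_neg (n : ℕ) (x : ℝ) : (genHe n).eval (-x) = (-1) ^ n * (genHe n).eval x := by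
  induction n using Nat.twoStepInduction with
  | zero => simp [genHe]
  | one => simp [genHe]
  | more n h1 h2 =>
    simp only [genHe, eval_sub, eval_mul, eval_X, eval_C, h1, h2]
    ring

/-! ### Gaussian orthogonality and expansions on the line. -/

theorem integrable_eval_mul_gaussian (p : ℝ[X]) :
    Integrable fun x : ℝ => p.eval x * Real.exp (-x ^ 2 / 2) := by
  induction p using Polynomial.induction_on' with
  | add p q hp hq =>
    simp only [eval_add, add_mul]
    exact hp.add hq
  | monomial n a =>
    have := (integrable_rpow_mul_exp_neg_mul_sq (b := 1 / 2) (by norm_num) (s := n)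
      (by have : (0 : ℝ) ≤ n := n.cast_nonneg
          linarith)).const_mul a
    refine this.congr (Filter.Eventually.of_forall fun x => ?_)
    simp only [eval_monomial, Real.rpow_natCast]
    rw [show -(1 / 2) * x ^ 2 = -x ^ 2 / 2 by ring]
    ring

/-- The expectation of a polynomial under the standard Gaussian law on the line. -/
def gaussMean : ℝ[X] →ₗ[ℝ] ℝ where
  toFun p := (√(2 * Real.pi))⁻¹ * ∫ x : ℝ, p.eval x * Real.exp (-x ^ 2 / 2)
  map_add' p q := by
    rw [← mul_add, ← integral_add (integrable_eval_mul_gaussian p) (integrable_eval_mul_gaussian q)]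
    simp [add_mul]
  map_smul' a p := by
    simp only [eval_smul, smul_eq_mul, mul_assoc, integral_const_mul, RingHom.id_apply]
    ring

theorem gaussMean_apply (p : ℝ[X]) :
    gaussMean p = (√(2 * Real.pi))⁻¹ * ∫ x : ℝ, p.eval x * Real.exp (-x ^ 2 / 2) := rfl

theorem gaussMean_one : gaussMean 1 = 1 := by
  have h := integral_gaussian (1 / 2)
  rw [show Real.pi / (1 / 2) = 2 * Real.pi by ring] at h
  have h1 : ∫ x : ℝ, (1 : ℝ[X]).eval x * Real.exp (-x ^ 2 / 2) = √(2 * Real.pi) := by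
    rw [← h]
    congr 1 with x
    rw [eval_one, one_mul, neg_mul, neg_div, one_div, div_eq_inv_mul]
  rw [gaussMean_apply, h1]
  exact inv_mul_cancel₀ (by positivity)

/-- Integration by parts: the integral of the derivative of $p(x)e^{-x^2/2}$ vanishes. -/
theorem gaussMean_X_mul (p : ℝ[X]) : gaussMean (X * p) = gaussMean (derivative p) := by
  have h1 : ∫ x : ℝ, (derivative p - X * p).eval x * Real.exp (-x ^ 2 / 2) = 0 := by
    refine integral_eq_zero_of_hasDerivAt_of_integrable
      (f := fun x => p.eval x * Real.exp (-x ^ 2 / 2)) (fun x => ?_)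
      (integrable_eval_mul_gaussian _) (integrable_eval_mul_gaussian _)
    have h2 : HasDerivAt (fun x : ℝ => -x ^ 2 / 2) (-x) x :=
      (((hasDerivAt_pow 2 x).neg).div_const 2).congr_deriv (by push_cast; ring)
    refine ((p.hasDerivAt x).mul h2.exp).congr_deriv ?_
    simp only [eval_sub, eval_mul, eval_X]
    ring
  have h2 : gaussMean (derivative p - X * p) = 0 := by rw [gaussMean_apply, h1, mul_zero]
  rw [map_sub] at h2
  linarith

/-- The operator $X-D$ that raises Hermite polynomials is the adjoint of $D$, so pairing with $He_n$
is the mean of the $n$-th derivative. Orthogonality and norms both follow from this. -/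
theorem gaussMean_He_mul (n : ℕ) (p : ℝ[X]) :
    gaussMean (He n * p) = gaussMean (derivative^[n] p) := by
  induction n generalizing p with
  | zero => simp [He_zero]
  | succ n ih =>
    rw [Function.iterate_succ_apply, ← ih, He_succ]
    have h := gaussMean_X_mul (He n * p)
    rw [derivative_mul, map_add] at h
    rw [sub_mul, map_sub, mul_assoc, h]
    ring

theorem gaussMean_He_mul_of_lt {n : ℕ} {p : ℝ[X]} (hp : p.degree < n) :
    gaussMean (He n * p) = 0 := by
  have : derivative^[n] p = 0 := by
    by_cases h0 : p = 0
    · simp [h0]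
    · exact iterate_derivative_eq_zero ((natDegree_lt_iff_degree_lt h0).2 hp)
  rw [gaussMean_He_mul, this, map_zero]

theorem gaussMean_He_mul_of_monic {n : ℕ} {p : ℝ[X]} (hp : p.Monic) (hn : p.natDegree = n) :
    gaussMean (He n * p) = n.factorial := by
  have h1 : gaussMean (He n * (p - X ^ n)) = 0 := by
    apply gaussMean_He_mul_of_lt
    have := degree_sub_lt_left (p := p) (q := X ^ n)
      (by rw [degree_X_pow, degree_eq_natDegree hp.ne_zero, hn]) hp.ne_zero
      (by rw [hp.leadingCoeff, (monic_X_pow n).leadingCoeff])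
    rwa [degree_eq_natDegree hp.ne_zero, hn] at this
  rw [mul_sub, map_sub, sub_eq_zero] at h1
  rw [h1, gaussMean_He_mul, iterate_derivative_X_pow_eq_smul, Nat.descFactorial_self]
  simp [gaussMean_one]

/-- The squared norm of `genHe n` for the weight `s² exp (-s² / 2)`. -/
def genNorm (n : ℕ) : ℝ := if Even n then (n + 1).factorial else (n + 2) * n.factorial

theorem genNorm_pos (n : ℕ) : 0 < genNorm n := by
  unfold genNorm
  split_ifs <;> positivity

theorem gaussMean_genHe_of_lt {n : ℕ} {p : ℝ[X]} (hp : p.degree < n) :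
    gaussMean (X ^ 2 * genHe n * p) = 0 := by
  rcases n.even_or_odd' with ⟨m, rfl | rfl⟩
  · rw [X_sq_mul_genHe_even, mul_assoc]
    apply gaussMean_He_mul_of_lt
    by_cases h0 : p = 0
    · rw [h0, mul_zero, degree_zero]; exact WithBot.bot_lt_coe _
    rw [X_mul, degree_mul_X, degree_eq_natDegree h0] at *
    norm_cast at *
    omega
  · rw [X_sq_mul_genHe_odd, add_mul, map_add, gaussMean_He_mul_of_lt, mul_assoc]
    · have : (2 * m + 3 : ℝ[X]) = C (2 * m + 3 : ℝ) := by
        simp only [map_add, map_mul, map_natCast, map_ofNat]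
      rw [this, ← smul_eq_C_mul, map_smul, gaussMean_He_mul_of_lt hp]
      simp
    · refine hp.trans ?_
      norm_cast
      omega

theorem gaussMean_genHe_of_monic {n : ℕ} {p : ℝ[X]} (hp : p.Monic) (hn : p.natDegree = n) :
    gaussMean (X ^ 2 * genHe n * p) = genNorm n := by
  rcases n.even_or_odd' with ⟨m, rfl | rfl⟩
  · rw [X_sq_mul_genHe_even, mul_assoc, gaussMean_He_mul_of_monic (monic_X.mul hp), genNorm,
      if_pos (by simp)]
    rw [natDegree_X_mul hp.ne_zero, hn]
  · rw [X_sq_mul_genHe_odd, add_mul, map_add, gaussMean_He_mul_of_lt, mul_assoc]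
    · have : (2 * m + 3 : ℝ[X]) = C (2 * m + 3 : ℝ) := by
        simp only [map_add, map_mul, map_natCast, map_ofNat]
      rw [this, ← smul_eq_C_mul, map_smul, gaussMean_He_mul_of_monic hp hn, genNorm,
        if_neg (by simp)]
      push_cast [Nat.factorial_succ, smul_eq_mul]
      ring
    · rw [degree_eq_natDegree hp.ne_zero, hn]
      norm_cast
      omega

/-- Subtracting the multiple of `genHe n` with the same top coefficient lowers the degree bound
without changing the earlier coefficients, by orthogonality. The explicit coefficients are those of
Gram–Schmidt. -/
theorem genHe_expansion {n : ℕ} {p : ℝ[X]} (hp : p.degree < n) :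
    p = ∑ k : Fin n, C (gaussMean (X ^ 2 * genHe k * p) / genNorm k) * genHe k := by
  induction n generalizing p with
  | zero =>
    have : p = 0 := by
      by_contra h0
      rw [degree_eq_natDegree h0] at hp
      norm_cast at hp
    simp [this]
  | succ n ih =>
    obtain ⟨hm, hd⟩ := genHe_degree n
    set a := p.coeff n with ha
    have hlt : (p - C a * genHe n).degree < n := by
      rw [degree_lt_iff_coeff_zero]
      intro m hmn
      rw [coeff_sub, coeff_C_mul]
      rcases hmn.eq_or_lt with rfl | hlt
      · have : (genHe n).coeff n = 1 := by
          have := hm.coeff_natDegree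
          rwa [hd] at this
        rw [this]; simp [ha]
      · rw [coeff_eq_zero_of_natDegree_lt (by omega : (genHe n).natDegree < m),
          (degree_lt_iff_coeff_zero _ _).1 hp m hlt]
        simp
    have hort : ∀ k : ℕ, k < n → gaussMean (X ^ 2 * genHe k * genHe n) = 0 := by
      intro k hk
      obtain ⟨hm', hd'⟩ := genHe_degree k
      rw [show X ^ 2 * genHe k * genHe n = X ^ 2 * genHe n * genHe k by ring]
      apply gaussMean_genHe_of_lt
      rw [degree_eq_natDegree hm'.ne_zero, hd']
      exact_mod_cast hk
    have hL : ∀ k : ℕ, gaussMean (X ^ 2 * genHe k * p) =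
        gaussMean (X ^ 2 * genHe k * (p - C a * genHe n)) +
          a * gaussMean (X ^ 2 * genHe k * genHe n) := by
      intro k
      rw [← smul_eq_mul a, ← map_smul, ← map_add, smul_eq_C_mul]
      congr 1
      ring
    rw [Fin.sum_univ_castSucc]
    have h1 := ih hlt
    have h2 : gaussMean (X ^ 2 * genHe n * p) / genNorm n = a := by
      rw [hL, gaussMean_genHe_of_lt hlt, gaussMean_genHe_of_monic hm hd, zero_add,
        mul_div_cancel_right₀ _ (genNorm_pos n).ne']
    simp only [Fin.val_last, Fin.val_castSucc, h2]
    rw [← sub_eq_iff_eq_add]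
    conv_lhs => rw [h1]
    refine Finset.sum_congr rfl fun k _ => ?_
    rw [hL k, hort k k.isLt, mul_zero, add_zero]

/-! ### The quaternionic scalar product in polar form, and identification of $Q_n$ and $h_n$. -/

theorem norm_pureQ (z : EuclideanSpace ℝ (Fin 3)) : ‖pureQ z‖ = ‖z‖ := by
  have h1 := Quaternion.normSq_eq_norm_mul_self (pureQ z)
  rw [Quaternion.normSq_def'] at h1
  have h2 := EuclideanSpace.real_norm_sq_eq z
  rw [Fin.sum_univ_three] at h2
  have h3 : ‖pureQ z‖ ^ 2 = ‖z‖ ^ 2 := by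
    rw [h2, sq, ← h1]
    simp [pureQ]
  exact (pow_left_inj₀ (norm_nonneg _) (norm_nonneg _) two_ne_zero).1 h3

theorem exists_polar_norm (z : EuclideanSpace ℝ (Fin 3)) :
    ∃ u : ℍ[ℝ], IsUnitPure u ∧ pureQ z = u * ((‖z‖ : ℝ) : ℍ[ℝ]) := by
  obtain ⟨u, s, hu, hz⟩ := exists_polar z
  have hs : ‖z‖ = |s| := by
    rw [← norm_pureQ, hz, norm_mul, hu.2, one_mul, Quaternion.norm_coe, Real.norm_eq_abs]
  rcases abs_cases s with ⟨h, -⟩ | ⟨h, -⟩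
  · exact ⟨u, hu, by rw [hs, h, hz]⟩
  · exact ⟨-u, hu.neg, by rw [hs, h, hz]; simp⟩

/-- The quaternionic polynomial `A` takes the value `uᵏ a(s)` at `us`. -/
def HasPolarForm (A : ℍ[ℝ][X]) (k : ℕ) (a : ℝ[X]) : Prop :=
  ∀ (u : ℍ[ℝ]) (s : ℝ), IsUnitPure u →
    rightEval A (u * (s : ℍ[ℝ])) = u ^ k * ((a.eval s : ℝ) : ℍ[ℝ])

theorem hasPolarForm_X_pow (n : ℕ) : HasPolarForm (X ^ n) n (X ^ n) := by
  intro u s _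
  rw [rightEval_X_pow,
    (show Commute u (s : ℍ[ℝ]) from (Quaternion.coe_commutes s u).symm).mul_pow]
  simp

section PolarForm

variable {A B : ℍ[ℝ][X]} {k m : ℕ} {a b : ℝ[X]}

theorem HasPolarForm.star_mul (hA : HasPolarForm A k a) (hB : HasPolarForm B m b) {u : ℍ[ℝ]}
    (s : ℝ) (hu : IsUnitPure u) :
    star (rightEval A (u * (s : ℍ[ℝ]))) * rightEval B (u * (s : ℍ[ℝ])) =
      u ^ (k + m) * (((-1) ^ k * a.eval s * b.eval s : ℝ) : ℍ[ℝ]) := by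
  rw [hA u s hu, hB u s hu, StarMul.star_mul, star_pow, hu.star_eq, Quaternion.star_coe, neg_pow,
    (Quaternion.coe_commutes (a.eval s) _), pow_add]
  push_cast
  have hc1 : Commute ((a.eval s : ℝ) : ℍ[ℝ]) (u ^ m) := Quaternion.coe_commute _ _
  have hc2 : Commute ((-1 : ℍ[ℝ]) ^ k) (u ^ k * u ^ m) := (Commute.neg_one_left _).pow_left k
  calc (-1) ^ k * u ^ k * ((a.eval s : ℝ) : ℍ[ℝ]) * (u ^ m * ((b.eval s : ℝ) : ℍ[ℝ]))
      = (-1) ^ k * u ^ k * (((a.eval s : ℝ) : ℍ[ℝ]) * u ^ m) * ((b.eval s : ℝ) : ℍ[ℝ]) := by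
        simp only [mul_assoc]
    _ = (-1) ^ k * (u ^ k * u ^ m) * (((a.eval s : ℝ) : ℍ[ℝ]) * ((b.eval s : ℝ) : ℍ[ℝ])) := by
        rw [hc1.eq]; simp only [mul_assoc]
    _ = _ := by rw [hc2.eq]; simp only [mul_assoc]

/-- The integrand is an odd power of $u$ times a real radial factor, so it changes sign under
$z\mapsto -z$. -/
theorem HasPolarForm.scalarProd_eq_zero (hA : HasPolarForm A k a) (hB : HasPolarForm B m b)
    (ho : Odd (k + m)) : scalarProd A B = 0 := by
  refine integral_odd fun z => ?_
  obtain ⟨u, s, hu, hz⟩ := exists_polar z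
  have hz' : pureQ (-z) = (-u) * (s : ℍ[ℝ]) := by
    rw [neg_mul, ← hz, pureQ_neg]
  rw [norm_neg, hz', hz, hA.star_mul hB s hu, hA.star_mul hB s hu.neg, ho.neg_pow, neg_mul,
    smul_neg]

/-- Polar coordinates give $4\pi\int_0^\infty r^2$; evenness turns this into $2\pi\int_{\mathbb R}$,
and $2\pi(2\pi)^{-3/2}$ is the normalization of the Gaussian on the line. -/
theorem integral_f_mul_eval_norm {p : ℝ[X]} (hp : ∀ x, p.eval (-x) = p.eval x) :
    ∫ z : EuclideanSpace ℝ (Fin 3), f ‖z‖ * p.eval ‖z‖ = gaussMean (X ^ 2 * p) := by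
  have h1 := integral_fun_norm_addHaar (volume : Measure (EuclideanSpace ℝ (Fin 3)))
    (fun r => f r * p.eval r)
  have h2 := integral_comp_abs (f := fun x => (X ^ 2 * p).eval x * Real.exp (-x ^ 2 / 2))
  have h3 : ∫ x : ℝ, (X ^ 2 * p).eval |x| * Real.exp (-|x| ^ 2 / 2) =
      ∫ x : ℝ, (X ^ 2 * p).eval x * Real.exp (-x ^ 2 / 2) := by
    congr 1 with x
    rcases abs_cases x with ⟨h, -⟩ | ⟨h, -⟩ <;> rw [h]
    simp only [eval_mul, eval_pow, eval_X, hp, neg_sq]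
  have h4 : ∫ y in Set.Ioi (0 : ℝ), y ^ 2 • (f y * p.eval y) = (2 * Real.pi) ^ (-(3 / 2) : ℝ) *
      ∫ y in Set.Ioi (0 : ℝ), (X ^ 2 * p).eval y * Real.exp (-y ^ 2 / 2) := by
    rw [← integral_const_mul]
    congr 1 with y
    simp only [eval_mul, eval_pow, eval_X, f, smul_eq_mul]
    ring
  have hv : (volume : Measure (EuclideanSpace ℝ (Fin 3))).real (Metric.ball 0 1) =
      Real.pi * 4 / 3 := by
    rw [Measure.real, EuclideanSpace.volume_ball_fin_three]
    simp only [ENNReal.ofReal_one, one_pow, one_mul]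
    exact ENNReal.toReal_ofReal (by positivity)
  have hpow : (2 * Real.pi) ^ (-(3 / 2) : ℝ) * (2 * Real.pi) = (√(2 * Real.pi))⁻¹ := by
    rw [Real.sqrt_eq_rpow, ← Real.rpow_neg (by positivity)]
    nth_rewrite 2 [← Real.rpow_one (2 * Real.pi)]
    rw [← Real.rpow_add (by positivity)]
    norm_num
  rw [h1, finrank_euclideanSpace, Fintype.card_fin, hv, h4, gaussMean_apply, ← h3, h2, ← hpow]
  simp only [nsmul_eq_mul, smul_eq_mul]
  push_cast
  ring

/-- Here $u^{k+m}=(-1)^j$ is real and conjugation contributes $(-1)^k$. The parities of $a$ and $b$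
make $ab$ even, as needed to pass from the half line to the line. -/
theorem HasPolarForm.scalarProd_eq (hA : HasPolarForm A k a) (hB : HasPolarForm B m b)
    (ha : ∀ x, a.eval (-x) = (-1) ^ k * a.eval x) (hb : ∀ x, b.eval (-x) = (-1) ^ m * b.eval x)
    {j : ℕ} (hj : k + m = 2 * j) :
    scalarProd A B = (((-1) ^ (k + j) * gaussMean (X ^ 2 * (a * b)) : ℝ) : ℍ[ℝ]) := by
  have hpt : ∀ z : EuclideanSpace ℝ (Fin 3),
      f ‖z‖ • (star (rightEval A (pureQ z)) * rightEval B (pureQ z)) =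
        coeIsom ((-1) ^ (k + j) * (f ‖z‖ * (a * b).eval ‖z‖)) := by
    intro z
    obtain ⟨u, hu, hz⟩ := exists_polar_norm z
    rw [hz, hA.star_mul hB _ hu, hj, hu.pow_even, ← Quaternion.coe_mul,
      ← Quaternion.coe_mul_eq_smul, ← Quaternion.coe_mul]
    change ((_ : ℝ) : ℍ[ℝ]) = ((_ : ℝ) : ℍ[ℝ])
    rw [eval_mul]
    congr 1
    ring
  have h2 := coeIsom.integral_comp_comm (μ := volume)
    (fun z : EuclideanSpace ℝ (Fin 3) => (-1) ^ (k + j) * (f ‖z‖ * (a * b).eval ‖z‖))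
  rw [scalarProd, integral_congr_ae (Filter.Eventually.of_forall hpt), h2, integral_const_mul,
    integral_f_mul_eval_norm]
  · rfl
  · intro x
    rw [eval_mul, eval_mul, ha, hb]
    have : ((-1 : ℝ) ^ k) * (-1) ^ m = 1 := by rw [← pow_add, hj, pow_mul]; simp
    linear_combination a.eval x * b.eval x * this

end PolarForm

theorem gaussMean_eq_zero_of_odd {p : ℝ[X]} (hp : ∀ x, p.eval (-x) = -p.eval x) :
    gaussMean p = 0 := by
  have h1 := integral_neg_eq_self (fun x : ℝ => p.eval x * Real.exp (-x ^ 2 / 2)) volume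
  simp only [hp, neg_sq, neg_mul, integral_neg] at h1
  rw [gaussMean_apply]
  have : ∫ x : ℝ, p.eval x * Real.exp (-x ^ 2 / 2) = 0 := by linarith
  rw [this, mul_zero]

theorem gaussMean_genHe_self (n : ℕ) : gaussMean (X ^ 2 * (genHe n * genHe n)) = genNorm n := by
  rw [← mul_assoc]
  exact gaussMean_genHe_of_monic (genHe_degree n).1 (genHe_degree n).2

/-- Each Gram–Schmidt correction equals $u^n$ times a term of the expansion of $X^n-{}$`genHe n`, a
polynomial of degree less than $n$; subtracting their sum from $(us)^n$ leaves `genHe n`. -/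
theorem hasPolarForm_P (n : ℕ) : HasPolarForm (P n) n (genHe n) := by
  induction n using Nat.strong_induction_on with
  | _ n ih =>
  intro u s hu
  have hXn : ∀ x : ℝ, ((X : ℝ[X]) ^ n).eval (-x) = (-1) ^ n * ((X : ℝ[X]) ^ n).eval x := by
    intro x
    simp only [eval_pow, eval_X]
    rw [neg_pow]
  have hterm : ∀ k : Fin n, rightEval (P k) (u * (s : ℍ[ℝ])) *
      ((scalarProd (P k) (P k))⁻¹ * scalarProd (P k) (X ^ n)) =
        u ^ n * (((gaussMean (X ^ 2 * genHe k * (X ^ n - genHe n)) / genNorm k *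
          (genHe k).eval s : ℝ)) : ℍ[ℝ]) := by
    intro k
    have hk := ih k k.isLt
    have h1 : scalarProd (P k) (P k) = ((genNorm k : ℝ) : ℍ[ℝ]) := by
      rw [hk.scalarProd_eq hk (genHe_eval_neg k) (genHe_eval_neg k) (two_mul _).symm,
        gaussMean_genHe_self, ← two_mul, pow_mul]
      simp
    -- `genHe n` is orthogonal to `genHe k` for $k<n$, so it may be inserted freely.
    have h2 : gaussMean (X ^ 2 * genHe k * (X ^ n - genHe n)) =
        gaussMean (X ^ 2 * (genHe k * X ^ n)) := by
      have h3 : gaussMean (X ^ 2 * genHe n * genHe k) = 0 := by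
        apply gaussMean_genHe_of_lt
        rw [degree_eq_natDegree (genHe_degree k).1.ne_zero, (genHe_degree k).2]
        exact_mod_cast k.isLt
      rw [show X ^ 2 * genHe k * (X ^ n - genHe n) =
        X ^ 2 * (genHe k * X ^ n) - X ^ 2 * genHe n * genHe k by ring, map_sub, h3, sub_zero]
    rw [h1, h2, hk u s hu]
    rcases Nat.even_or_odd (k + n) with he | ho
    · obtain ⟨i, hi⟩ : ∃ i, n = k + 2 * i := by
        obtain ⟨a, ha⟩ := he
        exact ⟨a - k, by have := k.isLt; omega⟩
      rw [hk.scalarProd_eq (hasPolarForm_X_pow n) (genHe_eval_neg k) hXn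
        (j := k + i) (by omega)]
      set g := gaussMean (X ^ 2 * (genHe k * X ^ n))
      -- The sign of the scalar product is the one relating $u^k$ to $u^n=u^{k+2i}$, so the signs
      -- cancel.
      have hs : ((-1 : ℝ) ^ (k + (k + i) : ℕ)) = (-1) ^ i := by
        rw [← add_assoc, ← two_mul, pow_add, pow_mul]; simp
      have hs' : ((-1 : ℝ) ^ i) * (-1) ^ i = 1 := by
        rw [← mul_pow]; simp
      have h3 : u ^ n = u ^ (k : ℕ) * (((-1 : ℝ) ^ i : ℝ) : ℍ[ℝ]) := by
        conv_lhs => rw [hi]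
        rw [pow_add, hu.pow_even]
      rw [hs, h3, ← Quaternion.coe_inv, ← Quaternion.coe_mul, mul_assoc, mul_assoc,
        ← Quaternion.coe_mul, ← Quaternion.coe_mul]
      congr 2
      ring
    -- For opposite parities both the quaternionic coefficient and the real one vanish.
    · rw [hk.scalarProd_eq_zero (hasPolarForm_X_pow n) ho, gaussMean_eq_zero_of_odd]
      · simp
      · intro x
        rw [eval_mul, eval_mul, eval_mul, eval_mul, genHe_eval_neg, hXn]
        have : ((-1 : ℝ) ^ (k : ℕ)) * (-1) ^ n = -1 := by rw [← pow_add, ho.neg_one_pow]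
        simp only [eval_pow, eval_X]
        linear_combination x ^ 2 * (genHe k).eval x * x ^ n * this
  have hexp := genHe_expansion (n := n) (p := X ^ n - genHe n) (by
    have := degree_sub_lt_left (p := X ^ n) (q := genHe n)
      (by rw [degree_X_pow, degree_eq_natDegree (genHe_degree n).1.ne_zero, (genHe_degree n).2])
      (monic_X_pow n).ne_zero
      (by rw [(genHe_degree n).1.leadingCoeff, (monic_X_pow n).leadingCoeff])
    rwa [degree_X_pow] at this)
  have heval := congrArg (eval s) hexp
  rw [eval_finsetSum, eval_sub, eval_pow, eval_X] at heval
  simp only [eval_mul, eval_C] at heval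
  have hsum : ∀ g : Fin n → ℝ, ((∑ k, g k : ℝ) : ℍ[ℝ]) = ∑ k, ((g k : ℝ) : ℍ[ℝ]) :=
    fun g => map_sum coeIsom.toLinearMap g _
  rw [rightEval_P, Finset.sum_congr rfl fun k _ => hterm k, ← Finset.mul_sum, ← hsum, ← heval,
    ← rightEval_X_pow, hasPolarForm_X_pow n u s hu, ← mul_sub, ← Quaternion.coe_sub]
  simp

/-- One unit pure quaternion suffices to pin down the chosen polynomial: $u^n$ cancels, leaving
equal values at every real $s$. -/
theorem Q_eq_genHe (n : ℕ) : Q n = genHe n := by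
  refine Polynomial.funext fun s => ?_
  have hu : IsUnitPure (pureQ !₂[1, 0, 0]) := by
    refine ⟨rfl, ?_⟩
    rw [norm_pureQ, EuclideanSpace.norm_eq, Fin.sum_univ_three]
    simp
  have h1 := (exists_Q n).choose_spec _ s hu
  rw [hasPolarForm_P n _ s hu] at h1
  have h0 : (pureQ !₂[1, 0, 0]) ^ n ≠ 0 := by
    apply pow_ne_zero
    rw [← norm_ne_zero_iff, hu.2]
    exact one_ne_zero
  exact (Quaternion.coe_injective (mul_left_cancel₀ h0 h1)).symm

theorem h_eq_genNorm (n : ℕ) : h n = genNorm n := by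
  rw [h, (hasPolarForm_P n).scalarProd_eq (hasPolarForm_P n) (genHe_eval_neg n) (genHe_eval_neg n)
    (two_mul _).symm, gaussMean_genHe_self, ← two_mul, pow_mul]
  simp

end
end QuatField

/-! ### Hermite functions and the kernel as a Wronskian. -/

namespace QuatField
noncomputable section

open Polynomial

/-- The Hermite function of index `N`, with squared `L²` norm `√(2π)`. -/
def hermiteFun (N : ℕ) (s : ℝ) : ℝ :=
  (He N).eval s * Real.exp (-s ^ 2 / 4) / √(N.factorial : ℝ)

/-- The derivative of the Hermite function of index `N`. -/
def hermiteFunDeriv (N : ℕ) (s : ℝ) : ℝ :=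
  ((derivative (He N)).eval s - s / 2 * (He N).eval s) * Real.exp (-s ^ 2 / 4) /
    √(N.factorial : ℝ)

theorem hasDerivAt_exp_neg_sq_div_four (s : ℝ) :
    HasDerivAt (fun s : ℝ => Real.exp (-s ^ 2 / 4)) (Real.exp (-s ^ 2 / 4) * (-s / 2)) s := by
  have : HasDerivAt (fun s : ℝ => -s ^ 2 / 4) (-s / 2) s :=
    (((hasDerivAt_pow 2 s).neg).div_const 4).congr_deriv (by push_cast; ring)
  exact this.exp

theorem hasDerivAt_hermiteFun (N : ℕ) (s : ℝ) :
    HasDerivAt (hermiteFun N) (hermiteFunDeriv N s) s := by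
  refine ((((He N).hasDerivAt s).mul (hasDerivAt_exp_neg_sq_div_four s)).div_const _).congr_deriv ?_
  rw [hermiteFunDeriv]
  ring

theorem He_ode (n : ℕ) :
    derivative (derivative (He n)) = X * derivative (He n) - (n : ℝ[X]) * He n := by
  have h := derivative_He_succ n
  rw [He_succ, derivative_sub, derivative_mul, derivative_X] at h
  linear_combination -h

/-- The harmonic oscillator equation: the Gaussian factor removes the first order term of Hermite's
equation. -/
theorem hasDerivAt_hermiteFunDeriv (N : ℕ) (s : ℝ) :
    HasDerivAt (hermiteFunDeriv N) (-(N + 1 / 2 - s ^ 2 / 4) * hermiteFun N s) s := by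
  have h1 := ((derivative (He N)).hasDerivAt s).sub
    (((hasDerivAt_id s).div_const 2).mul ((He N).hasDerivAt s))
  refine ((h1.mul (hasDerivAt_exp_neg_sq_div_four s)).div_const _).congr_deriv ?_
  rw [hermiteFun, He_ode]
  simp only [eval_sub, eval_mul, eval_X, eval_natCast, id, Pi.sub_apply, Pi.mul_apply]
  ring

/-- The part of the kernel `rhoN n` that is not given by the Wronskian of Hermite functions. -/
def kernelRem (n : ℕ) (s t : ℝ) : ℝ :=
  if Even n then hermiteFun (n + 1) s * hermiteFun (n + 1) t
  else (s / 2 * hermiteFun (n + 1) s - hermiteFunDeriv (n + 1) s) *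
    (t / 2 * hermiteFun (n + 1) t - hermiteFunDeriv (n + 1) t) / (n + 2)

theorem genHe_even_eval (m : ℕ) {s : ℝ} (hs : s ≠ 0) :
    (genHe (2 * m)).eval s = (He (2 * m + 1)).eval s / s := by
  rw [← (genHe_hermite m).1, eval_mul, eval_X, mul_div_cancel_left₀ _ hs]

theorem genHe_odd_eval (m : ℕ) {s : ℝ} (hs : s ≠ 0) :
    (genHe (2 * m + 1)).eval s =
      (s * (He (2 * m + 2)).eval s + (He (2 * m + 1)).eval s) / s ^ 2 := by
  have h := congrArg (eval s) (genHe_hermite m).2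
  simp only [eval_mul, eval_pow, eval_X, eval_add] at h
  rw [← h, mul_div_cancel_left₀ _ (pow_ne_zero 2 hs)]

/-- In both parities $Q_n$ and $Q_{n+1}$ are expressed through $He_{n+1}$ and its derivative alone.
For odd $n$ this uses $He_n=He_{n+1}'/(n+1)$, and the factors $\frac s2h-h'$ in `kernelRem` come
from $He_{n+2}$. -/
theorem rhoN_eq_wronskian (n : ℕ) {s t : ℝ} (hs : s ≠ 0) (ht : t ≠ 0) (hst : s ≠ t) :
    rhoN n s t * (Real.exp (-s ^ 2 / 4) * Real.exp (-t ^ 2 / 4)) =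
      1 / (s * t) * ((hermiteFunDeriv (n + 1) s * hermiteFun (n + 1) t -
        hermiteFun (n + 1) s * hermiteFunDeriv (n + 1) t) / (t - s) +
          hermiteFun (n + 1) s * hermiteFun (n + 1) t / 2) -
      kernelRem n s t / (s ^ 2 * t ^ 2) := by
  have hts : t - s ≠ 0 := sub_ne_zero.2 hst.symm
  have hr : √((n + 1).factorial : ℝ) ≠ 0 := by positivity
  have hr2 : √((n + 1).factorial : ℝ) ^ 2 = (n + 1).factorial := Real.sq_sqrt (by positivity)
  have hd : ∀ x : ℝ, (He (n + 2)).eval x =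
      x * (He (n + 1)).eval x - (derivative (He (n + 1))).eval x := by
    intro x; rw [He_succ (n + 1), eval_sub, eval_mul, eval_X]
  rw [rhoN, if_neg hst, Q_eq_genHe, Q_eq_genHe, h_eq_genNorm, genNorm, kernelRem]
  simp only [hermiteFun, hermiteFunDeriv]
  rcases n.even_or_odd' with ⟨m, rfl | rfl⟩
  · rw [if_pos (by simp), if_pos (by simp), genHe_even_eval m hs, genHe_even_eval m ht,
      genHe_odd_eval m hs, genHe_odd_eval m ht, hd, hd]
    generalize √((2 * m + 1).factorial : ℝ) = r at *
    rw [← hr2]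
    field_simp
    ring
  · have hn : ((2 * m + 1 + 1).factorial : ℝ) = (2 * m + 2) * (2 * m + 1).factorial := by
      rw [Nat.factorial_succ]; push_cast; ring
    have hdd : ∀ x : ℝ, (derivative (He (2 * m + 1 + 1))).eval x =
        (2 * m + 2) * (He (2 * m + 1)).eval x := by
      intro x
      rw [derivative_He_succ, eval_mul, eval_add, eval_natCast, eval_one]
      push_cast
      ring
    have hf : ((2 * m + 1).factorial : ℝ) = √((2 * m + 1 + 1).factorial : ℝ) ^ 2 / (2 * m + 2) := by
      rw [hr2, hn]; field_simp
    have e : 2 * m + 1 + 1 = 2 * (m + 1) := by ring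
    rw [if_neg (by simp), if_neg (by simp), genHe_odd_eval m hs, genHe_odd_eval m ht]
    rw [e, genHe_even_eval _ hs, genHe_even_eval _ ht, ← e, show 2 * m + 1 + 1 + 1 = 2 * m + 1 + 2 by rfl,
      hd, hd, hdd, hdd, hf]
    have h2 : (2 * (m : ℝ) + 2) ≠ 0 := by positivity
    have h3 : (2 * (m : ℝ) + 1 + 2) ≠ 0 := by positivity
    push_cast
    generalize √((2 * m + 1 + 1).factorial : ℝ) = r at *
    field_simp
    ring

theorem sqrt_f_mul_f (s t : ℝ) : √(f s * f t) =
    (2 * Real.pi) ^ (-(3 / 2) : ℝ) * (Real.exp (-s ^ 2 / 4) * Real.exp (-t ^ 2 / 4)) := by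
  have h : ∀ x : ℝ, Real.exp (-x ^ 2 / 2) = Real.exp (-x ^ 2 / 4) ^ 2 := by
    intro x; rw [← Real.exp_nat_mul]; congr 1; push_cast; ring
  rw [f, f, h, h, ← Real.sqrt_sq (by positivity : 0 ≤ (2 * Real.pi) ^ (-(3 / 2) : ℝ) *
    (Real.exp (-s ^ 2 / 4) * Real.exp (-t ^ 2 / 4)))]
  congr 1
  ring

/-! ### The angle variable and the amplitude at the origin. -/

/-- The Hermite function of index `N` in the angle variable `s = 2 √(N + 1/2) cos θ`. -/
def angleFun (N : ℕ) (θ : ℝ) : ℝ := hermiteFun N (2 * √(N + 1 / 2 : ℝ) * Real.cos θ)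

/-- The rescaled derivative of the Hermite function in the angle variable. -/
def angleDeriv (N : ℕ) (θ : ℝ) : ℝ :=
  hermiteFunDeriv N (2 * √(N + 1 / 2 : ℝ) * Real.cos θ) / √(N + 1 / 2 : ℝ)

theorem hasDerivAt_angleFun (N : ℕ) (θ : ℝ) :
    HasDerivAt (angleFun N) (-((2 * N + 1) * Real.sin θ * angleDeriv N θ)) θ := by
  have hpos : 0 < (N + 1 / 2 : ℝ) := by positivity
  have h1 := (hasDerivAt_hermiteFun N _).comp θ
    ((Real.hasDerivAt_cos θ).const_mul (2 * √(N + 1 / 2 : ℝ)))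
  refine h1.congr_deriv ?_
  rw [angleDeriv]
  have hne : √(N + 1 / 2 : ℝ) ≠ 0 := by positivity
  have hsq : (2 * N + 1 : ℝ) = 2 * √(N + 1 / 2 : ℝ) ^ 2 := by
    rw [Real.sq_sqrt hpos.le]; ring
  rw [hsq]
  field_simp

theorem hasDerivAt_angleDeriv (N : ℕ) (θ : ℝ) :
    HasDerivAt (angleDeriv N) ((2 * N + 1) * Real.sin θ ^ 3 * angleFun N θ) θ := by
  have hpos : 0 < (N + 1 / 2 : ℝ) := by positivity
  have h1 := ((hasDerivAt_hermiteFunDeriv N _).comp θ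
    ((Real.hasDerivAt_cos θ).const_mul (2 * √(N + 1 / 2 : ℝ)))).div_const √(N + 1 / 2 : ℝ)
  refine h1.congr_deriv ?_
  have hne : √(N + 1 / 2 : ℝ) ≠ 0 := by positivity
  rw [angleFun]
  have hsq : (N : ℝ) + 1 / 2 = √(N + 1 / 2 : ℝ) ^ 2 := by
    rw [Real.sq_sqrt hpos.le]
  have hs : Real.sin θ ^ 2 = 1 - Real.cos θ ^ 2 := Real.sin_sq θ
  set F := hermiteFun N (2 * √(N + 1 / 2 : ℝ) * Real.cos θ)
  set l := √(N + 1 / 2 : ℝ)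
  have hN : (N : ℝ) = l ^ 2 - 1 / 2 := by linarith
  rw [hN, show Real.sin θ ^ 3 = Real.sin θ * (1 - Real.cos θ ^ 2) by rw [← hs]; ring]
  field_simp
  ring

/-- $He_{2m}(0)^2/(2m)!$ is the central binomial coefficient over $4^m$; its square obeys the
recurrence of the Wallis product. -/
theorem He_eval_zero (m : ℕ) : (He (2 * m + 1)).eval 0 = 0 ∧
    (((He (2 * m)).eval 0) ^ 2 / (2 * m).factorial) ^ 2 =
      1 / ((2 * m + 1) * Real.Wallis.W m) := by
  induction m with
  | zero => simp [He_zero, He_one, Real.Wallis.W]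
  | succ m ih =>
    obtain ⟨h1, h2⟩ := ih
    have e1 : (He (2 * (m + 1))).eval 0 = -(2 * m + 1) * (He (2 * m)).eval 0 := by
      rw [show 2 * (m + 1) = 2 * m + 2 by ring, He_add_two]
      simp only [eval_sub, eval_mul, eval_X, eval_add, eval_natCast, eval_one]
      push_cast
      ring
    refine ⟨?_, ?_⟩
    · rw [show 2 * (m + 1) + 1 = 2 * m + 1 + 2 by ring, He_add_two]
      simp [h1]
    · have hf : ((2 * (m + 1)).factorial : ℝ) = (2 * m + 2) * (2 * m + 1) * (2 * m).factorial := by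
        rw [show 2 * (m + 1) = 2 * m + 1 + 1 by ring, Nat.factorial_succ, Nat.factorial_succ]
        push_cast; ring
      have hW := Real.Wallis.W_pos m
      have h4 : (2 * (m : ℝ) + 2) ≠ 0 := by positivity
      have h5 : (2 * (m : ℝ) + 1) ≠ 0 := by positivity
      have h6 : (2 * (m : ℝ) + 3) ≠ 0 := by positivity
      have h7 : ((2 * m).factorial : ℝ) ≠ 0 := by positivity
      have h3 : (He (2 * (m + 1))).eval 0 ^ 2 / (2 * (m + 1)).factorial =
          (2 * m + 1) / (2 * m + 2) * ((He (2 * m)).eval 0 ^ 2 / (2 * m).factorial) := by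
        rw [e1, hf]
        field_simp
      rw [h3, mul_pow, h2, Real.Wallis.W_succ]
      push_cast
      rw [show 2 * ((m : ℝ) + 1) + 1 = 2 * m + 3 by ring]
      field_simp

/-- The adiabatic invariant of the Hermite function of index `N`. -/
def adiabatic (N : ℕ) : ℝ := angleFun N (Real.pi / 2) ^ 2 + angleDeriv N (Real.pi / 2) ^ 2

/-- Used with $p=2/\pi$ and $q=1/W_m$; the factor $c/b$, equal to $1-\frac1{2b}$, is what remains of
the powers of $N+\frac12$ in each parity. -/
theorem abs_mul_div_sub_le {p q a b : ℝ} (ha : 1 ≤ a) (hp : 0 ≤ p) (hp1 : p ≤ 1) (hpq : p ≤ q)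
    (hq : q ≤ p * ((a + 1) / a)) (hab : a ≤ b) (c : ℝ) (hc : c = b - 1 / 2) :
    |c / b * q - p| ≤ 1 / a := by
  have ha0 : 0 < a := by linarith
  have hb0 : 0 < b := by linarith
  have h1 : q - p ≤ p / a := by
    have : p * ((a + 1) / a) = p + p / a := by field_simp
    linarith
  have h2 : p / a ≤ 1 / a := by gcongr
  have h3 : p / a ≤ p := div_le_self hp ha
  have h4 : c / b * q = q - q / 2 / b := by rw [hc]; field_simp
  have h5 : q / 2 / b ≤ 1 / a := by
    have : q / 2 ≤ 1 := by linarith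
    gcongr
  have h6 : 0 ≤ q / 2 / b := by
    have : 0 ≤ q := hp.trans hpq
    positivity
  rw [abs_le, h4]
  constructor <;> linarith

/-- At $s=0$ parity kills either the Hermite function or its derivative, and the survivor is
governed by $He_{2m}(0)$. The two-sided Wallis bounds then give an explicit rate. -/
theorem adiabatic_sq_bound (N : ℕ) (hN : 1 ≤ N) :
    |(√(N + 1 / 2 : ℝ) * adiabatic N) ^ 2 - 2 / Real.pi| ≤ (1 / N : ℝ) := by
  have hpos : 0 < (N + 1 / 2 : ℝ) := by positivity
  have hsq : √(N + 1 / 2 : ℝ) ^ 2 = N + 1 / 2 := Real.sq_sqrt hpos.le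
  have hne : √(N + 1 / 2 : ℝ) ≠ 0 := by positivity
  have hpi := Real.pi_gt_three
  have hp1 : 2 / Real.pi ≤ 1 := by rw [div_le_one (by positivity)]; linarith
  have hW : ∀ m : ℕ, 2 / Real.pi ≤ 1 / Real.Wallis.W m ∧
      1 / Real.Wallis.W m ≤ 2 / Real.pi * ((2 * m + 1 + 1) / (2 * m + 1)) := by
    intro m
    have h0 := Real.Wallis.W_pos m
    constructor
    · rw [div_le_div_iff₀ (by positivity) h0]
      linarith [Real.Wallis.W_le m]
    · have h1 := Real.Wallis.le_W m
      have : 2 / Real.pi * ((2 * m + 1 + 1) / (2 * m + 1)) =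
          1 / (((2 : ℝ) * m + 1) / (2 * m + 2) * (Real.pi / 2)) := by
        field_simp
        ring
      rw [this]
      exact one_div_le_one_div_of_le (by positivity) h1
  rcases N.even_or_odd' with ⟨m, rfl | rfl⟩
  · obtain ⟨hlo, hhi⟩ := hW m
    obtain ⟨-, hz⟩ := He_eval_zero m
    have hd0 : (derivative (He (2 * m))).eval 0 = 0 := by
      cases m with
      | zero => simp [He_zero]
      | succ k =>
        rw [show 2 * (k + 1) = 2 * k + 1 + 1 by ring, derivative_He_succ, eval_mul,
          (He_eval_zero k).1, mul_zero]
    have hB : adiabatic (2 * m) = (He (2 * m)).eval 0 ^ 2 / (2 * m).factorial := by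
      rw [adiabatic, angleFun, angleDeriv, Real.cos_pi_div_two, mul_zero, hermiteFun,
        hermiteFunDeriv, hd0]
      simp only [ne_eq, OfNat.ofNat_ne_zero, not_false_eq_true, zero_pow, neg_zero, zero_div,
        Real.exp_zero, mul_one, zero_mul, sub_zero, add_zero, div_pow]
      rw [Real.sq_sqrt (by positivity)]
    rw [mul_pow, hB, hz, hsq]
    have := abs_mul_div_sub_le (a := 2 * m + 1) (b := 2 * m + 1) (by linarith [m.cast_nonneg (α := ℝ)])
      (by positivity) hp1 hlo hhi le_rfl _ rfl
    have h2 : (1 : ℝ) / (2 * m + 1) ≤ (1 / (2 * m : ℕ) : ℝ) := by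
      apply one_div_le_one_div_of_le
      · exact_mod_cast hN
      · push_cast; linarith
    refine le_trans (le_of_eq ?_) (this.trans h2)
    congr 2
    push_cast
    have h0 := Real.Wallis.W_pos m
    field_simp
    ring
  · obtain ⟨hlo, hhi⟩ := hW m
    obtain ⟨h00, hz⟩ := He_eval_zero m
    have hB : adiabatic (2 * m + 1) = (2 * m + 1) *
        ((He (2 * m)).eval 0 ^ 2 / (2 * m).factorial) / √((2 * m + 1 : ℕ) + 1 / 2 : ℝ) ^ 2 := by
      rw [adiabatic, angleFun, angleDeriv, Real.cos_pi_div_two, mul_zero, hermiteFun,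
        hermiteFunDeriv, h00, derivative_He_succ]
      simp only [ne_eq, OfNat.ofNat_ne_zero, not_false_eq_true, zero_pow, neg_zero, zero_div,
        Real.exp_zero, mul_one, zero_mul, sub_zero, zero_add, div_pow, eval_mul, eval_add,
        eval_natCast, eval_one, mul_pow]
      rw [Real.sq_sqrt (by positivity : (0 : ℝ) ≤ (2 * m + 1).factorial), Nat.factorial_succ]
      have : ((2 * m).factorial : ℝ) ≠ 0 := by positivity
      push_cast
      field_simp
    have hl : ∀ x : ℝ, (√((2 * m + 1 : ℕ) + 1 / 2 : ℝ) *
        ((2 * m + 1) * x / √((2 * m + 1 : ℕ) + 1 / 2 : ℝ) ^ 2)) ^ 2 =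
          (2 * m + 1) ^ 2 * x ^ 2 / √((2 * m + 1 : ℕ) + 1 / 2 : ℝ) ^ 2 := by
      intro x; field_simp
    rw [hB, hl, hz, hsq]
    have := abs_mul_div_sub_le (a := 2 * m + 1) (b := 2 * m + 3 / 2)
      (by linarith [m.cast_nonneg (α := ℝ)])
      (by positivity) hp1 hlo hhi (by linarith) _ rfl
    refine le_trans (le_of_eq ?_) (this.trans (le_of_eq ?_))
    · congr 2
      push_cast
      have h0 := Real.Wallis.W_pos m
      field_simp
      ring
    · push_cast; rfl

theorem adiabatic_nonneg (N : ℕ) : 0 ≤ adiabatic N := by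
  unfold adiabatic; positivity

theorem adiabatic_bound (N : ℕ) (hN : 1 ≤ N) :
    |√(N + 1 / 2 : ℝ) * adiabatic N - √(2 / Real.pi)| ≤ (2 / N : ℝ) := by
  have h := adiabatic_sq_bound N hN
  have hpi := Real.pi_pos
  have hpi4 := Real.pi_le_four
  set x := √(N + 1 / 2 : ℝ) * adiabatic N
  have hx : 0 ≤ x := mul_nonneg (Real.sqrt_nonneg _) (adiabatic_nonneg N)
  set c := √(2 / Real.pi)
  have hc : c ^ 2 = 2 / Real.pi := Real.sq_sqrt (by positivity)
  have hc2 : 1 / 2 ≤ c := by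
    apply Real.le_sqrt_of_sq_le
    rw [le_div_iff₀ hpi]
    linarith
  rw [← hc, sq_sub_sq, abs_mul, abs_of_nonneg (by positivity : 0 ≤ x + c)] at h
  -- The limit $c=\sqrt{2/\pi}$ is at least $\frac12$, so taking the square root costs only a factor
  -- 2.
  have h1 : 1 / 2 * |x - c| ≤ (x + c) * |x - c| := by
    gcongr
    linarith
  have h2 : (2 : ℝ) / N = 2 * (1 / N) := by ring
  rw [h2]
  linarith

end
end QuatField

/-! ### The angular system: adiabatic invariant and frozen-frequency rotation. -/

namespace QuatField
noncomputable section

section AngularSystem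

variable {Y Z : ℝ → ℝ} {L : ℝ}

/-- The adiabatic quantity of the angular system, without its first order correction. -/
def angEnergy (Y Z : ℝ → ℝ) (θ : ℝ) : ℝ := Z θ ^ 2 / Real.sin θ + Real.sin θ * Y θ ^ 2

/-- The adiabatic quantity of the angular system with its first order correction. -/
def angEnergyCorr (L : ℝ) (Y Z : ℝ → ℝ) (θ : ℝ) : ℝ :=
  angEnergy Y Z θ - Real.cos θ / (L * Real.sin θ ^ 3) * (Y θ * Z θ)

/-- The derivative of the bare energy is $\cos\theta\,(Y^2-Z^2/\sin^2\theta)$, while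
$(YZ)'=L\sin^3\theta\,(Y^2-Z^2/\sin^2\theta)$. The correction cancels this oscillating term and
leaves a multiple of $YZ$ of size $1/L$. -/
theorem hasDerivAt_angEnergyCorr (hL : 0 < L)
    (hY : ∀ θ, HasDerivAt Y (-(L * Real.sin θ * Z θ)) θ)
    (hZ : ∀ θ, HasDerivAt Z (L * Real.sin θ ^ 3 * Y θ) θ) {θ : ℝ} (hθ : 0 < Real.sin θ) :
    HasDerivAt (angEnergyCorr L Y Z)
      ((1 / Real.sin θ ^ 2 + 3 * Real.cos θ ^ 2 / Real.sin θ ^ 4) / L * (Y θ * Z θ)) θ := by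
  have hs := Real.hasDerivAt_sin θ
  have hc := Real.hasDerivAt_cos θ
  have h1 := (((hZ θ).pow 2).div hs hθ.ne').add (hs.mul ((hY θ).pow 2))
  have h2 := (hc.div ((hs.pow 3).const_mul L) (mul_pos hL (pow_pos hθ 3)).ne').mul ((hY θ).mul (hZ θ))
  refine (h1.sub h2).congr_deriv ?_
  simp only [Pi.pow_apply, Pi.mul_apply, Pi.div_apply]
  push_cast
  field_simp
  ring

theorem abs_mul_le_angEnergy {θ : ℝ} (hθ : 0 < Real.sin θ) :
    |Y θ * Z θ| ≤ angEnergy Y Z θ / 2 := by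
  have h : angEnergy Y Z θ = (Z θ ^ 2 + (Real.sin θ * Y θ) ^ 2) / Real.sin θ := by
    rw [angEnergy]; field_simp
  rw [h, le_div_iff₀ two_pos, le_div_iff₀ hθ]
  have h1 := two_mul_le_add_sq |Z θ| |Real.sin θ * Y θ|
  rw [sq_abs, sq_abs, abs_mul, abs_of_pos hθ] at h1
  rw [abs_mul]
  linarith

/-- A Grönwall argument from $\pi/2$ down to $\theta$: the corrected energy $J$ satisfies $|J'|\le
aJ$, so $Je^{ax}$ increases and $Je^{-ax}$ decreases. At $\pi/2$ the correction vanishes with the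
cosine. -/
theorem angEnergy_sub_le {c : ℝ} (hY : ∀ θ, HasDerivAt Y (-(L * Real.sin θ * Z θ)) θ)
    (hZ : ∀ θ, HasDerivAt Z (L * Real.sin θ ^ 3 * Y θ) θ) (hc : 0 < c) (hc1 : c ≤ 1)
    (hL : 8 / c ^ 4 ≤ L) {θ : ℝ} (h0 : 0 ≤ θ) (h1 : θ ≤ Real.pi / 2) (hθ : c ≤ Real.sin θ) :
    |angEnergy Y Z θ - (Y (Real.pi / 2) ^ 2 + Z (Real.pi / 2) ^ 2)| ≤
      28 / c ^ 4 / L * (Y (Real.pi / 2) ^ 2 + Z (Real.pi / 2) ^ 2) := by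
  have hL0 : 0 < L := lt_of_lt_of_le (by positivity) hL
  -- Bounds both the coefficient of the correction and that of the derivative,
  -- $1/\sin^2+3\cos^2/\sin^4\le 4/c^4$. The hypothesis on $L$ makes it at most $\frac12$.
  set a := 4 / c ^ 4 / L with ha
  have ha0 : 0 < a := by positivity
  have ha1 : a ≤ 1 / 2 := by
    rw [ha, div_le_iff₀ hL0]
    have : 8 / c ^ 4 = 2 * (4 / c ^ 4) := by ring
    linarith
  set B := Y (Real.pi / 2) ^ 2 + Z (Real.pi / 2) ^ 2 with hB
  have hsin : ∀ x ∈ Set.Icc θ (Real.pi / 2), c ≤ Real.sin x := fun x hx =>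
    hθ.trans (Real.sin_le_sin_of_le_of_le_pi_div_two (by linarith [Real.pi_pos]) hx.2 hx.1)
  have hcoef : ∀ x ∈ Set.Icc θ (Real.pi / 2),
      |angEnergyCorr L Y Z x - angEnergy Y Z x| ≤ a * (angEnergy Y Z x / 2) ∧
      |(1 / Real.sin x ^ 2 + 3 * Real.cos x ^ 2 / Real.sin x ^ 4) / L * (Y x * Z x)| ≤
        a * (angEnergy Y Z x / 2) := by
    intro x hx
    have hs := hsin x hx
    have hs0 : 0 < Real.sin x := hc.trans_le hs
    have hsq := Real.cos_sq_le_one x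
    have hab := abs_mul_le_angEnergy (Y := Y) (Z := Z) hs0
    have hc34 : c ^ 4 ≤ c ^ 3 := pow_le_pow_of_le_one hc.le hc1 (by norm_num)
    have hc24 : c ^ 4 ≤ c ^ 2 := pow_le_pow_of_le_one hc.le hc1 (by norm_num)
    constructor
    · rw [angEnergyCorr, sub_sub_cancel_left, abs_neg, abs_mul]
      refine mul_le_mul ?_ hab (abs_nonneg _) ha0.le
      rw [abs_div, abs_of_pos (by positivity : 0 < L * Real.sin x ^ 3), ha, div_div, mul_comm (c ^ 4)]
      have h3 : L * c ^ 4 ≤ L * Real.sin x ^ 3 := by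
        gcongr
        exact hc34.trans (by gcongr)
      refine div_le_div₀ (by norm_num) ?_ (by positivity) h3
      linarith [Real.abs_cos_le_one x]
    · rw [abs_mul]
      refine mul_le_mul ?_ hab (abs_nonneg _) ha0.le
      rw [abs_of_nonneg (by positivity), ha]
      gcongr
      have e1 : 1 / Real.sin x ^ 2 ≤ 1 / c ^ 4 := by
        apply one_div_le_one_div_of_le (by positivity)
        exact hc24.trans (by gcongr)
      have e2 : 3 * Real.cos x ^ 2 / Real.sin x ^ 4 ≤ 3 / c ^ 4 := by
        refine div_le_div₀ (by norm_num) ?_ (by positivity) (by gcongr)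
        linarith
      have : 4 / c ^ 4 = 1 / c ^ 4 + 3 / c ^ 4 := by ring
      linarith
  have henn : ∀ x ∈ Set.Icc θ (Real.pi / 2), 0 ≤ angEnergy Y Z x := by
    intro x hx
    have hs0 : 0 < Real.sin x := hc.trans_le (hsin x hx)
    unfold angEnergy
    positivity
  have hle : ∀ x ∈ Set.Icc θ (Real.pi / 2), angEnergy Y Z x / 2 ≤ angEnergyCorr L Y Z x := by
    intro x hx
    have h2 := (abs_le.1 (hcoef x hx).1).1
    nlinarith [henn x hx]
  have hderiv : ∀ x ∈ Set.Icc θ (Real.pi / 2), HasDerivAt (angEnergyCorr L Y Z)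
      ((1 / Real.sin x ^ 2 + 3 * Real.cos x ^ 2 / Real.sin x ^ 4) / L * (Y x * Z x)) x :=
    fun x hx => hasDerivAt_angEnergyCorr hL0 hY hZ (hc.trans_le (hsin x hx))
  have hJ : ∀ x ∈ Set.Icc θ (Real.pi / 2),
      |(1 / Real.sin x ^ 2 + 3 * Real.cos x ^ 2 / Real.sin x ^ 4) / L * (Y x * Z x)| ≤
        a * angEnergyCorr L Y Z x := fun x hx =>
    (hcoef x hx).2.trans (by gcongr; exact hle x hx)
  have hexp : ∀ b x : ℝ, HasDerivAt (fun x => Real.exp (b * x)) (Real.exp (b * x) * b) x := by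
    intro b x
    simpa using ((hasDerivAt_id x).const_mul b).exp
  have hend : angEnergyCorr L Y Z (Real.pi / 2) = B := by
    rw [angEnergyCorr, angEnergy, Real.cos_pi_div_two, Real.sin_pi_div_two, hB]
    ring
  have hmθ : θ ∈ Set.Icc θ (Real.pi / 2) := ⟨le_rfl, h1⟩
  have hmπ : Real.pi / 2 ∈ Set.Icc θ (Real.pi / 2) := ⟨h1, le_rfl⟩
  have hup : angEnergyCorr L Y Z θ ≤ B * Real.exp (2 * a) := by
    have hmono : MonotoneOn (fun x => angEnergyCorr L Y Z x * Real.exp (a * x))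
        (Set.Icc θ (Real.pi / 2)) := by
      refine monotoneOn_of_hasDerivWithinAt_nonneg (convex_Icc _ _)
        (fun x hx => ((hderiv x hx).mul (hexp a x)).continuousAt.continuousWithinAt)
        (fun x hx => ((hderiv x (interior_subset hx)).mul (hexp a x)).hasDerivWithinAt)
        fun x hx => ?_
      have h2 := (abs_le.1 (hJ x (interior_subset hx))).1
      have h3 := Real.exp_pos (a * x)
      nlinarith
    have h2 := hmono hmθ hmπ h1
    simp only [hend] at h2
    have hB0 : 0 ≤ B := by positivity
    have h3 : angEnergyCorr L Y Z θ * Real.exp (a * θ) ≤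
        B * Real.exp (2 * a) * Real.exp (a * θ) := by
      refine h2.trans ?_
      rw [mul_assoc, ← Real.exp_add]
      gcongr
      have := Real.pi_le_four
      nlinarith
    exact le_of_mul_le_mul_right h3 (Real.exp_pos _)
  have hlow : B * Real.exp (-(2 * a)) ≤ angEnergyCorr L Y Z θ := by
    have hanti : AntitoneOn (fun x => angEnergyCorr L Y Z x * Real.exp (-a * x))
        (Set.Icc θ (Real.pi / 2)) := by
      refine antitoneOn_of_hasDerivWithinAt_nonpos (convex_Icc _ _)
        (fun x hx => ((hderiv x hx).mul (hexp (-a) x)).continuousAt.continuousWithinAt)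
        (fun x hx => ((hderiv x (interior_subset hx)).mul (hexp (-a) x)).hasDerivWithinAt)
        fun x hx => ?_
      have h2 := (abs_le.1 (hJ x (interior_subset hx))).2
      have h3 := Real.exp_pos (-a * x)
      nlinarith
    have h2 := hanti hmθ hmπ h1
    simp only [hend] at h2
    have hB0 : 0 ≤ B := by positivity
    have h3 : B * Real.exp (-(2 * a)) * Real.exp (-a * θ) ≤
        angEnergyCorr L Y Z θ * Real.exp (-a * θ) := by
      refine le_trans ?_ h2
      rw [mul_assoc, ← Real.exp_add]
      gcongr
      have := Real.pi_le_four
      nlinarith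
    exact le_of_mul_le_mul_right h3 (Real.exp_pos _)
  have hB0 : 0 ≤ B := by positivity
  have he1 : Real.exp (2 * a) ≤ 1 + 4 * a := by
    have := Real.abs_exp_sub_one_le (x := 2 * a) (by rw [abs_of_pos (by positivity)]; linarith)
    rw [abs_of_pos (by positivity : 0 < 2 * a)] at this
    linarith [(abs_le.1 this).2]
  have he2 : 1 - 2 * a ≤ Real.exp (-(2 * a)) := by
    linarith [Real.add_one_le_exp (-(2 * a))]
  -- The corrected energy is within $4aB$ of $B$, and the correction is at most $3aB$.
  have h28 : 28 / c ^ 4 / L = 7 * a := by rw [ha]; ring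
  have hcor := abs_le.1 (hcoef θ hmθ).1
  have hle' := hle θ hmθ
  have hJup : angEnergyCorr L Y Z θ ≤ B + 4 * a * B := by nlinarith
  have hJlow : B - 2 * a * B ≤ angEnergyCorr L Y Z θ := by nlinarith
  have haJ : a * (angEnergy Y Z θ / 2) ≤ a * (3 * B) := by
    gcongr
    nlinarith
  rw [h28, abs_le]
  constructor
  · linarith [hcor.2, mul_nonneg ha0.le hB0]
  · linarith [hcor.1, mul_nonneg ha0.le hB0]

/-- If $\sin\theta$ were identically $c$, then $(cY,Z)$ would rotate at constant speed
$\kappa=Lc^2$. Rotating it back gives two functions $g,k$ whose derivatives contain only the error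
$\sin\theta-c$, so they barely move between $r$ and $t$. -/
theorem abs_wronskian_add_le {c D E r t : ℝ}
    (hY : ∀ θ, HasDerivAt Y (-(L * Real.sin θ * Z θ)) θ)
    (hZ : ∀ θ, HasDerivAt Z (L * Real.sin θ ^ 3 * Y θ) θ) (hL : 0 ≤ L) (hc0 : 0 ≤ c) (hc1 : c ≤ 1)
    (hYD : ∀ θ ∈ Set.uIcc r t, |Y θ| ≤ D) (hZD : ∀ θ ∈ Set.uIcc r t, |Z θ| ≤ D)
    (hE : ∀ θ ∈ Set.uIcc r t, L * |Real.sin θ - c| ≤ E) :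
    |c * (Z r * Y t - Y r * Z t) + (c ^ 2 * Y r ^ 2 + Z r ^ 2) * Real.sin (L * c ^ 2 * (t - r))| ≤
      16 * E * D ^ 2 * |t - r| := by
  have hD : 0 ≤ D := (abs_nonneg _).trans (hYD r Set.left_mem_uIcc)
  have hE0 : 0 ≤ E := le_trans (by positivity) (hE r Set.left_mem_uIcc)
  set κ := L * c ^ 2 with hκ
  have hsin : ∀ x, HasDerivAt (fun x => Real.sin (κ * (x - r))) (Real.cos (κ * (x - r)) * κ) x := by
    intro x
    simpa using (((hasDerivAt_id x).sub_const r).const_mul κ).sin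
  have hcos : ∀ x, HasDerivAt (fun x => Real.cos (κ * (x - r))) (-Real.sin (κ * (x - r)) * κ) x := by
    intro x
    simpa using (((hasDerivAt_id x).sub_const r).const_mul κ).cos
  have herr : ∀ x ∈ Set.uIcc r t, ∀ u v : ℝ, |u| ≤ 1 → |v| ≤ 1 →
      |L * c * (c - Real.sin x) * Z x * u + L * (Real.sin x ^ 3 - c ^ 3) * Y x * v| ≤
        -- One $E$ comes from $c-\sin$, and three from $\sin^3-c^3$ with its quadratic cofactor at
        -- most 3.
        4 * E * D := by
    intro x hx u v hu hv
    have e1 : |L * c * (c - Real.sin x) * Z x * u| ≤ E * D * 1 := by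
      rw [show L * c * (c - Real.sin x) * Z x * u = c * (L * (c - Real.sin x)) * Z x * u by ring,
        abs_mul, abs_mul, abs_mul, abs_mul, abs_sub_comm, abs_of_nonneg hc0, abs_of_nonneg hL]
      have := mul_le_mul hc1 (hE x hx) (by positivity) zero_le_one
      rw [one_mul] at this
      gcongr
      exact hZD x hx
    have e2 : |L * (Real.sin x ^ 3 - c ^ 3) * Y x * v| ≤ (E * 3) * D * 1 := by
      rw [show L * (Real.sin x ^ 3 - c ^ 3) * Y x * v =
        (L * (Real.sin x - c)) * (Real.sin x ^ 2 + Real.sin x * c + c ^ 2) * Y x * v by ring,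
        abs_mul, abs_mul, abs_mul, abs_mul, abs_of_nonneg hL]
      have hq : |Real.sin x ^ 2 + Real.sin x * c + c ^ 2| ≤ 3 := by
        have h1 := Real.sin_le_one x
        have h2 := Real.neg_one_le_sin x
        rw [abs_le]
        constructor <;> nlinarith
      gcongr
      · exact hE x hx
      · exact hYD x hx
    calc _ ≤ _ := abs_add_le _ _
      _ ≤ 4 * E * D := by linarith
  have hg : ∀ x, HasDerivAt
      (fun x => c * Y x * Real.cos (κ * (x - r)) + Z x * Real.sin (κ * (x - r)))
      (L * c * (c - Real.sin x) * Z x * Real.cos (κ * (x - r)) +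
        L * (Real.sin x ^ 3 - c ^ 3) * Y x * Real.sin (κ * (x - r))) x := by
    intro x
    refine ((((hY x).const_mul c).mul (hcos x)).add ((hZ x).mul (hsin x))).congr_deriv ?_
    rw [hκ]
    ring
  have hk : ∀ x, HasDerivAt
      (fun x => Z x * Real.cos (κ * (x - r)) - c * Y x * Real.sin (κ * (x - r)))
      (L * c * (c - Real.sin x) * Z x * (-Real.sin (κ * (x - r))) +
        L * (Real.sin x ^ 3 - c ^ 3) * Y x * Real.cos (κ * (x - r))) x := by
    intro x
    refine (((hZ x).mul (hcos x)).sub (((hY x).const_mul c).mul (hsin x))).congr_deriv ?_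
    rw [hκ]
    ring
  have hG := (convex_uIcc r t).norm_image_sub_le_of_norm_hasDerivWithin_le
    (fun x _ => (hg x).hasDerivWithinAt)
    (fun x hx => herr x hx _ _ (Real.abs_cos_le_one _) (Real.abs_sin_le_one _))
    Set.left_mem_uIcc Set.right_mem_uIcc
  have hK := (convex_uIcc r t).norm_image_sub_le_of_norm_hasDerivWithin_le
    (fun x _ => (hk x).hasDerivWithinAt)
    (fun x hx => herr x hx _ _ (by rw [abs_neg]; exact Real.abs_sin_le_one _)
      (Real.abs_cos_le_one _))
    Set.left_mem_uIcc Set.right_mem_uIcc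
  simp only [sub_self, mul_zero, Real.cos_zero, Real.sin_zero, mul_one, add_zero, sub_zero,
    Real.norm_eq_abs] at hG hK
  have hsc := Real.sin_sq_add_cos_sq (κ * (t - r))
  set S := Real.sin (κ * (t - r))
  set C := Real.cos (κ * (t - r))
  set dg := c * Y t * C + Z t * S - c * Y r with hdg
  set dk := Z t * C - c * Y t * S - Z r with hdk
  -- The exact rotation satisfies this with right side zero; what remains is linear in the
  -- increments of $g$ and $k$.
  have hkey : c * (Z r * Y t - Y r * Z t) + (c ^ 2 * Y r ^ 2 + Z r ^ 2) * S =
      dg * (Z r * C - c * Y r * S) + dk * (-(Z r * S) - c * Y r * C) := by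
    rw [hdg, hdk]
    linear_combination (-(c * Z r * Y t) + c * Y r * Z t) * hsc
  have hab : ∀ u v : ℝ, |u| ≤ 1 → |v| ≤ 1 → |Z r * u - c * Y r * v| ≤ 2 * D := by
    intro u v hu hv
    have e1 : |Z r * u| ≤ D * 1 := by
      rw [abs_mul]; gcongr; exact hZD r Set.left_mem_uIcc
    have e2 : |c * Y r * v| ≤ 1 * D * 1 := by
      rw [abs_mul, abs_mul, abs_of_nonneg hc0]; gcongr; exact hYD r Set.left_mem_uIcc
    calc _ ≤ _ := abs_sub _ _
      _ ≤ 2 * D := by linarith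
  have hS : |S| ≤ 1 := Real.abs_sin_le_one _
  have hC : |C| ≤ 1 := Real.abs_cos_le_one _
  rw [hkey]
  calc _ ≤ _ := abs_add_le _ _
    _ ≤ 4 * E * D * |t - r| * (2 * D) + 4 * E * D * |t - r| * (2 * D) := by
      rw [abs_mul, abs_mul]
      gcongr
      · exact hab C S hC hS
      · have := hab (-S) C (by rwa [abs_neg]) hC
        rwa [mul_neg] at this
    _ = 16 * E * D ^ 2 * |t - r| := by ring

end AngularSystem

end
end QuatField

/-! ### The Lipschitz bound for sinc and big-O rules for products and inverses. -/

namespace QuatField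
noncomputable section

open Asymptotics Filter Topology

theorem sinc_eq_integral (x : ℝ) : Real.sinc x = ∫ u in (0 : ℝ)..1, Real.cos (x * u) := by
  by_cases hx : x = 0
  · simp [hx]
  · rw [intervalIntegral.integral_comp_mul_left (fun u => Real.cos u) hx, integral_cos,
      Real.sinc_of_ne_zero hx]
    simp [div_eq_inv_mul]

/-- Sinc is the average of $\cos(xu)$ over $u\in[0,1]$, and each of these is 1-Lipschitz in $x$. -/
theorem abs_sinc_sub_sinc_le (x y : ℝ) : |Real.sinc x - Real.sinc y| ≤ |x - y| := by
  rw [sinc_eq_integral, sinc_eq_integral, ← intervalIntegral.integral_sub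
    (Continuous.intervalIntegrable (by fun_prop) _ _)
    (Continuous.intervalIntegrable (by fun_prop) _ _)]
  have h := intervalIntegral.norm_integral_le_of_norm_le_const (a := (0 : ℝ)) (b := 1)
    (C := |x - y|) (f := fun u => Real.cos (x * u) - Real.cos (y * u)) (fun u hu => by
      rw [Set.uIoc_of_le zero_le_one] at hu
      have h1 := Real.abs_cos_sub_cos_le (x * u) (y * u)
      rw [← sub_mul, abs_mul, abs_of_pos hu.1] at h1
      exact h1.trans (mul_le_of_le_one_right (abs_nonneg _) hu.2))
  simpa using h

section BigO

variable {α : Type*} {l : Filter α} {u u' v v' e : α → ℝ}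

theorem isBigO_mul_sub_mul (hu : (fun p => u p - u' p) =O[l] e)
    (hv : (fun p => v p - v' p) =O[l] e) (hu1 : u' =O[l] (1 : α → ℝ)) (hv' : v' =O[l] (1 : α → ℝ))
    (he : e =O[l] (1 : α → ℝ)) : (fun p => u p * v p - u' p * v' p) =O[l] e := by
  have hv1 : v =O[l] (1 : α → ℝ) := ((hv.trans he).add hv').congr_left fun p => by ring
  have h1 : (fun p => (u p - u' p) * v p) =O[l] e := (hu.mul hv1).congr_right fun p => by simp
  have h2 : (fun p => u' p * (v p - v' p)) =O[l] e := (hu1.mul hv).congr_right fun p => by simp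
  exact (h1.add h2).congr_left fun p => by ring

theorem isBigO_one_of_abs_le {C : ℝ} (h : ∀ᶠ p in l, |u p| ≤ C) : u =O[l] (1 : α → ℝ) :=
  IsBigO.of_bound C (h.mono fun p hp => by simpa using hp)

theorem isBigO_inv_sub_inv {δ : ℝ} (hδ : 0 < δ) (hu : ∀ᶠ p in l, δ ≤ |u p|)
    (hu' : ∀ᶠ p in l, δ ≤ |u' p|) (h : (fun p => u p - u' p) =O[l] e) :
    (fun p => (u p)⁻¹ - (u' p)⁻¹) =O[l] e := by
  have hinv : ∀ w : α → ℝ, (∀ᶠ p in l, δ ≤ |w p|) → (fun p => (w p)⁻¹) =O[l] (1 : α → ℝ) := by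
    intro w hw
    refine isBigO_one_of_abs_le (C := δ⁻¹) (hw.mono fun p hp => ?_)
    rw [abs_inv]
    exact inv_anti₀ hδ hp
  have h1 := (h.neg_left.mul (hinv u hu)).mul (hinv u' hu')
  have h2 : (fun p => e p * (1 : α → ℝ) p * (1 : α → ℝ) p) = e := by ext p; simp
  rw [h2] at h1
  refine h1.congr' ?_ EventuallyEq.rfl
  filter_upwards [hu, hu'] with p hp hp'
  have h0 : u p ≠ 0 := by rw [← abs_pos]; linarith
  have h0' : u' p ≠ 0 := by rw [← abs_pos]; linarith
  field_simp
  ring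

end BigO

/-! ### Uniform estimates in the bulk. -/

/-- The angle of the rescaled point `rescaledPoint x₀ σ n`. -/
def scaledAngle (x₀ σ : ℝ) (n : ℕ) : ℝ :=
  Real.arccos x₀ + σ / (2 * Real.sin (Real.arccos x₀) ^ 2) * (1 / (n : ℝ))

/-- The filter of parameters `(n, x₀, σ, τ)` with `n → ∞`, uniformly for `x₀ ∈ [ε, 1 - ε]` and
distinct `σ`, `τ` bounded by `M`. -/
def bulk (ε M : ℝ) : Filter (ℕ × ℝ × ℝ × ℝ) :=
  atTop ×ˢ 𝓟 {q | q.1 ∈ Set.Icc ε (1 - ε) ∧ |q.2.1| ≤ M ∧ |q.2.2| ≤ M ∧ q.2.1 ≠ q.2.2}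

theorem eventually_bulk {ε M : ℝ} {P : ℕ → ℝ → ℝ → ℝ → Prop} :
    (∀ᶠ p in bulk ε M, P p.1 p.2.1 p.2.2.1 p.2.2.2) ↔
      ∀ᶠ n in atTop, ∀ x₀ ∈ Set.Icc ε (1 - ε), ∀ σ τ : ℝ, |σ| ≤ M → |τ| ≤ M → σ ≠ τ →
        P n x₀ σ τ := by
  rw [bulk, eventually_prod_principal_iff]
  refine eventually_congr (Eventually.of_forall fun n => ⟨fun h x₀ hx σ τ h1 h2 h3 =>
    h (x₀, σ, τ) ⟨hx, h1, h2, h3⟩, fun h q hq => h q.1 hq.1 q.2.1 q.2.2 hq.2.1 hq.2.2.1 hq.2.2.2⟩)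

/-- Elementary facts on the angles near `arccos x₀`. -/
structure BulkAngle (ε K : ℝ) (n : ℕ) (x₀ θ : ℝ) : Prop where
  nonneg : 0 ≤ θ
  le_pi_div_two : θ ≤ Real.pi / 2
  sin_ge : ε / 2 ≤ Real.sin θ
  cos_ge : ε / 2 ≤ Real.cos θ
  abs_sin_sub : |Real.sin θ - Real.sin (Real.arccos x₀)| ≤ K / n
  abs_cos_sub : |Real.cos θ - x₀| ≤ K / n

theorem sin_arccos_bounds {ε x₀ : ℝ} (hε : 0 < ε) (hx : x₀ ∈ Set.Icc ε (1 - ε)) :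
    ε ≤ Real.sin (Real.arccos x₀) ∧ ε ≤ Real.sin (Real.arccos x₀) ^ 2 ∧
      Real.sin (Real.arccos x₀) ≤ 1 := by
  obtain ⟨h1, h2⟩ := hx
  have h3 : Real.sin (Real.arccos x₀) ^ 2 = 1 - x₀ ^ 2 := by
    rw [Real.sin_arccos, Real.sq_sqrt (by nlinarith)]
  have h4 : ε ≤ Real.sin (Real.arccos x₀) ^ 2 := by rw [h3]; nlinarith
  have h5 := Real.sin_le_one (Real.arccos x₀)
  have h6 : 0 ≤ Real.sin (Real.arccos x₀) := by rw [Real.sin_arccos]; exact Real.sqrt_nonneg _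
  exact ⟨by nlinarith, h4, h5⟩

theorem bulkAngle_of_abs_le {ε K : ℝ} {n : ℕ} {x₀ θ : ℝ} (hε : 0 < ε)
    (hx : x₀ ∈ Set.Icc ε (1 - ε)) (hn : K / n ≤ ε / 2) (hθ : |θ - Real.arccos x₀| ≤ K / n) :
    BulkAngle ε K n x₀ θ := by
  obtain ⟨hs, -, -⟩ := sin_arccos_bounds hε hx
  obtain ⟨h1, h2⟩ := hx
  have hcos : Real.cos (Real.arccos x₀) = x₀ := Real.cos_arccos (by linarith) (by linarith)
  have e1 := (Real.abs_sin_sub_sin_le θ (Real.arccos x₀)).trans hθ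
  have e2 := (Real.abs_cos_sub_cos_le θ (Real.arccos x₀)).trans hθ
  rw [hcos] at e2
  -- Both $\phi$ and $\pi/2-\phi=\arcsin x_0$ are at least $\varepsilon$, so a perturbation by
  -- $\varepsilon/2$ stays inside $[0,\pi/2]$.
  have hφ : Real.sin (Real.arccos x₀) ≤ Real.arccos x₀ := Real.sin_le (Real.arccos_nonneg x₀)
  have hφ' : x₀ ≤ Real.pi / 2 - Real.arccos x₀ := by
    rw [← Real.arcsin_eq_pi_div_two_sub_arccos]
    have h3 := Real.sin_le (Real.arcsin_nonneg.2 (hε.le.trans h1))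
    rwa [Real.sin_arcsin (by linarith) (by linarith)] at h3
  have a0 := abs_le.1 hθ
  have a1 := abs_le.1 e1
  have a2 := abs_le.1 e2
  exact ⟨by linarith, by linarith, by linarith, by linarith, e1, e2⟩

theorem abs_scaledAngle_sub_le {ε M x₀ σ : ℝ} {n : ℕ} (hε : 0 < ε) (hx : x₀ ∈ Set.Icc ε (1 - ε))
    (hσ : |σ| ≤ M) : |scaledAngle x₀ σ n - Real.arccos x₀| ≤ M / (2 * ε) / n := by
  obtain ⟨-, hs, -⟩ := sin_arccos_bounds hε hx
  have hs0 : 0 < 2 * Real.sin (Real.arccos x₀) ^ 2 := by linarith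
  have hn : (0 : ℝ) ≤ n := n.cast_nonneg
  rw [scaledAngle, add_sub_cancel_left, mul_one_div, abs_div, abs_div, abs_of_pos hs0,
    abs_of_nonneg hn]
  gcongr
  exact (abs_nonneg σ).trans hσ

/-- The scale `√(n + 3/2)`: the rescaled points are `2 * bulkScale n * cos θ`. -/
def bulkScale (n : ℕ) : ℝ := √(((n + 1 : ℕ) : ℝ) + 1 / 2)

theorem bulkScale_sq (n : ℕ) : bulkScale n ^ 2 = n + 3 / 2 := by
  rw [bulkScale, Real.sq_sqrt (by positivity)]
  push_cast
  ring

theorem bulkScale_pos (n : ℕ) : 0 < bulkScale n := by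
  unfold bulkScale; positivity

/-- The shift $\frac32$ is $1+\frac12$: the points of the theorem are exactly the angle variable of
the Hermite function of index $n+1$. -/
theorem rescaledPoint_eq (x₀ σ : ℝ) (n : ℕ) :
    rescaledPoint x₀ σ n = 2 * bulkScale n * Real.cos (scaledAngle x₀ σ n) := by
  rw [bulkScale]
  push_cast
  rw [rescaledPoint, scaledAngle, show (n : ℝ) + 1 + 1 / 2 = n + 3 / 2 by ring]

/-- The amplitude bound for the Hermite function of index `n + 1` in the bulk. -/
def bulkAmp (ε : ℝ) (n : ℕ) : ℝ := √(10 / ε * adiabatic (n + 1))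

theorem bulkAmp_sq {ε : ℝ} (hε : 0 < ε) (n : ℕ) :
    bulkAmp ε n ^ 2 = 10 / ε * adiabatic (n + 1) :=
  Real.sq_sqrt (mul_nonneg (by positivity) (adiabatic_nonneg _))

theorem bulkScale_mul_adiabatic_sub_le {n : ℕ} (hn : 1 ≤ n) :
    |bulkScale n * adiabatic (n + 1) - √(2 / Real.pi)| ≤ 2 / n := by
  refine (adiabatic_bound (n + 1) (by omega)).trans ?_
  have : (0 : ℝ) < n := by exact_mod_cast hn
  push_cast
  gcongr
  linarith

theorem sqrt_two_div_pi_le : √(2 / Real.pi) ≤ 1 := by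
  rw [Real.sqrt_le_one, div_le_one Real.pi_pos]
  linarith [Real.pi_gt_three]

theorem bulkScale_mul_adiabatic_le {n : ℕ} (hn : 1 ≤ n) :
    bulkScale n * adiabatic (n + 1) ≤ 3 := by
  have h := (abs_le.1 (bulkScale_mul_adiabatic_sub_le hn)).2
  have h1 : (2 : ℝ) / n ≤ 2 := div_le_self two_pos.le (by exact_mod_cast hn)
  linarith [sqrt_two_div_pi_le]

theorem bulkScale_mul_bulkAmp_sq_le {ε : ℝ} (hε : 0 < ε) {n : ℕ} (hn : 1 ≤ n) :
    bulkScale n * bulkAmp ε n ^ 2 ≤ 30 / ε := by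
  rw [bulkAmp_sq hε]
  have := mul_le_mul_of_nonneg_left (bulkScale_mul_adiabatic_le hn) (by positivity : 0 ≤ 10 / ε)
  calc _ = 10 / ε * (bulkScale n * adiabatic (n + 1)) := by ring
    _ ≤ 10 / ε * 3 := this
    _ = 30 / ε := by ring

/-- The parameters `(n, x₀, σ, τ)` are in the bulk regime. -/
structure BulkRegime (ε M : ℝ) (n : ℕ) (x₀ σ τ : ℝ) : Prop where
  pos : 0 < ε
  one_le : 1 ≤ n
  mem : x₀ ∈ Set.Icc ε (1 - ε)
  left_le : |σ| ≤ M
  right_le : |τ| ≤ M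
  ne : σ ≠ τ
  angle : ∀ θ, |θ - Real.arccos x₀| ≤ M / (2 * ε) / n → BulkAngle ε (M / (2 * ε)) n x₀ θ
  small : M / (2 * ε) / n ≤ ε / 2
  large : 8 / (ε / 2) ^ 4 ≤ 2 * ((n + 1 : ℕ) : ℝ) + 1

theorem eventually_bulkRegime {ε : ℝ} (hε : 0 < ε) (M : ℝ) :
    ∀ᶠ p in bulk ε M, BulkRegime ε M p.1 p.2.1 p.2.2.1 p.2.2.2 := by
  rw [eventually_bulk]
  have h1 : Tendsto (fun n : ℕ => M / (2 * ε) / (n : ℝ)) atTop (𝓝 0) :=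
    tendsto_const_div_atTop_nhds_zero_nat _
  filter_upwards [h1.eventually_le_const (by positivity : 0 < ε / 2), eventually_ge_atTop 1,
    tendsto_natCast_atTop_atTop.eventually_ge_atTop (8 / (ε / 2) ^ 4)] with n hn hn1 hn2
  intro x₀ hx σ τ hσ hτ hne
  refine ⟨hε, hn1, hx, hσ, hτ, hne, fun θ hθ => bulkAngle_of_abs_le hε hx hn hθ, hn, ?_⟩
  push_cast
  linarith

namespace BulkRegime

variable {ε M : ℝ} {n : ℕ} {x₀ σ τ : ℝ}

theorem symm (h : BulkRegime ε M n x₀ σ τ) : BulkRegime ε M n x₀ τ σ :=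
  ⟨h.pos, h.one_le, h.mem, h.right_le, h.left_le, h.ne.symm, h.angle, h.small, h.large⟩

theorem cast_pos (h : BulkRegime ε M n x₀ σ τ) : (0 : ℝ) < n := by exact_mod_cast h.one_le

theorem le_half (h : BulkRegime ε M n x₀ σ τ) : ε ≤ 1 / 2 := by linarith [h.mem.1, h.mem.2]

theorem bound_nonneg (h : BulkRegime ε M n x₀ σ τ) : 0 ≤ M := (abs_nonneg _).trans h.left_le

theorem left (h : BulkRegime ε M n x₀ σ τ) :
    BulkAngle ε (M / (2 * ε)) n x₀ (scaledAngle x₀ σ n) :=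
  h.angle _ (abs_scaledAngle_sub_le h.pos h.mem h.left_le)

theorem right (h : BulkRegime ε M n x₀ σ τ) :
    BulkAngle ε (M / (2 * ε)) n x₀ (scaledAngle x₀ τ n) := h.symm.left

theorem between (h : BulkRegime ε M n x₀ σ τ) {θ : ℝ}
    (hθ : θ ∈ Set.uIcc (scaledAngle x₀ σ n) (scaledAngle x₀ τ n)) :
    BulkAngle ε (M / (2 * ε)) n x₀ θ := by
  refine h.angle θ ?_
  have h1 := abs_le.1 (abs_scaledAngle_sub_le (n := n) h.pos h.mem h.left_le)
  have h2 := abs_le.1 (abs_scaledAngle_sub_le (n := n) h.pos h.mem h.right_le)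
  rw [Set.mem_uIcc] at hθ
  rw [abs_le]
  rcases hθ with ⟨h3, h4⟩ | ⟨h3, h4⟩ <;> constructor <;> linarith

theorem scaledAngle_sub (h : BulkRegime ε M n x₀ σ τ) :
    scaledAngle x₀ τ n - scaledAngle x₀ σ n =
      (τ - σ) / (2 * Real.sin (Real.arccos x₀) ^ 2 * n) := by
  have hc := (sin_arccos_bounds h.pos h.mem).2.1
  have hc0 : Real.sin (Real.arccos x₀) ≠ 0 := by
    intro h0; rw [h0] at hc; linarith [h.pos]
  have hn := h.cast_pos.ne'
  rw [scaledAngle, scaledAngle]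
  field_simp
  ring

theorem scaledAngle_sub_ne_zero (h : BulkRegime ε M n x₀ σ τ) :
    scaledAngle x₀ τ n - scaledAngle x₀ σ n ≠ 0 := by
  have hc := (sin_arccos_bounds h.pos h.mem).2.1
  have hn := h.cast_pos
  rw [h.scaledAngle_sub]
  refine div_ne_zero (sub_ne_zero.2 h.ne.symm) ?_
  have : 0 < Real.sin (Real.arccos x₀) ^ 2 := h.pos.trans_le hc
  positivity

theorem energy (h : BulkRegime ε M n x₀ σ τ) {θ : ℝ}
    (hθ : BulkAngle ε (M / (2 * ε)) n x₀ θ) :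
    |angEnergy (angleFun (n + 1)) (angleDeriv (n + 1)) θ - adiabatic (n + 1)| ≤
      28 / (ε / 2) ^ 4 / (2 * ((n + 1 : ℕ) : ℝ) + 1) * adiabatic (n + 1) :=
  angEnergy_sub_le (hasDerivAt_angleFun (n + 1)) (hasDerivAt_angleDeriv (n + 1))
    (half_pos h.pos) (by linarith [h.le_half]) h.large hθ.nonneg hθ.le_pi_div_two hθ.sin_ge

theorem amplitude (h : BulkRegime ε M n x₀ σ τ) {θ : ℝ}
    (hθ : BulkAngle ε (M / (2 * ε)) n x₀ θ) :
    |angleFun (n + 1) θ| ≤ bulkAmp ε n ∧ |angleDeriv (n + 1) θ| ≤ bulkAmp ε n := by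
  have hε := h.pos
  have hB := adiabatic_nonneg (n + 1)
  have h1 := (abs_le.1 (h.energy hθ)).2
  have hL : (0 : ℝ) < 2 * ((n + 1 : ℕ) : ℝ) + 1 := by positivity
  -- So the energy is at most five times its value at $\pi/2$; dividing by
  -- $\sin\theta\ge\varepsilon/2$ produces the $10/\varepsilon$ in `bulkAmp`.
  have h2 : 28 / (ε / 2) ^ 4 / (2 * ((n + 1 : ℕ) : ℝ) + 1) ≤ 4 := by
    rw [div_le_iff₀ hL]
    have : 28 / (ε / 2) ^ 4 = 7 / 2 * (8 / (ε / 2) ^ 4) := by ring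
    linarith [h.large]
  have h3 : angEnergy (angleFun (n + 1)) (angleDeriv (n + 1)) θ ≤ 5 * adiabatic (n + 1) := by
    nlinarith
  have hs := hθ.sin_ge
  have hs0 : 0 < Real.sin θ := by linarith
  have hs1 := Real.sin_le_one θ
  rw [angEnergy] at h3
  have h5 : 0 ≤ angleDeriv (n + 1) θ ^ 2 / Real.sin θ := by positivity
  have h6 : 0 ≤ Real.sin θ * angleFun (n + 1) θ ^ 2 := by positivity
  constructor <;> refine Real.abs_le_sqrt ?_
  · rw [div_mul_eq_mul_div, le_div_iff₀ hε]
    nlinarith [sq_nonneg (angleFun (n + 1) θ)]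
  · have h7 : angleDeriv (n + 1) θ ^ 2 ≤ angleDeriv (n + 1) θ ^ 2 / Real.sin θ :=
      le_div_self (sq_nonneg _) hs0 hs1
    have h8 : 5 * adiabatic (n + 1) ≤ 10 / ε * adiabatic (n + 1) := by
      gcongr
      rw [le_div_iff₀ hε]
      linarith [h.le_half]
    linarith

theorem wronskian (h : BulkRegime ε M n x₀ σ τ) :
    |Real.sin (Real.arccos x₀) *
        (angleDeriv (n + 1) (scaledAngle x₀ σ n) * angleFun (n + 1) (scaledAngle x₀ τ n) -
          angleFun (n + 1) (scaledAngle x₀ σ n) * angleDeriv (n + 1) (scaledAngle x₀ τ n)) +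
      (Real.sin (Real.arccos x₀) ^ 2 * angleFun (n + 1) (scaledAngle x₀ σ n) ^ 2 +
        angleDeriv (n + 1) (scaledAngle x₀ σ n) ^ 2) *
          Real.sin ((2 * ((n + 1 : ℕ) : ℝ) + 1) * Real.sin (Real.arccos x₀) ^ 2 *
            (scaledAngle x₀ τ n - scaledAngle x₀ σ n))| ≤
      16 * (5 * (M / (2 * ε))) * bulkAmp ε n ^ 2 *
        |scaledAngle x₀ τ n - scaledAngle x₀ σ n| := by
  obtain ⟨hc0, -, hc1⟩ := sin_arccos_bounds h.pos h.mem
  have hn := h.cast_pos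
  have hn1 : (1 : ℝ) ≤ n := by exact_mod_cast h.one_le
  have hK : 0 ≤ M / (2 * ε) := div_nonneg h.bound_nonneg (by linarith [h.pos])
  refine abs_wronskian_add_le (hasDerivAt_angleFun (n + 1)) (hasDerivAt_angleDeriv (n + 1))
    (by positivity) (h.pos.le.trans hc0) hc1 (fun θ hθ => (h.amplitude (h.between hθ)).1)
    (fun θ hθ => (h.amplitude (h.between hθ)).2) (fun θ hθ => ?_)
  -- The frequency is $2n+3\le 5n$ and the sine deviates by $O(1/n)$, so the freezing error $E$ is
  -- bounded.
  calc _ ≤ (2 * ((n + 1 : ℕ) : ℝ) + 1) * (M / (2 * ε) / n) := by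
        gcongr
        exact (h.between hθ).abs_sin_sub
    _ ≤ 5 * n * (M / (2 * ε) / n) := by
        gcongr
        push_cast
        linarith
    _ = _ := by field_simp

/-- Mean value inequality for $\cos\theta+\theta\sin\phi$, whose derivative is $O(1/n)$ between the
two angles. -/
theorem abs_cos_slope_add (h : BulkRegime ε M n x₀ σ τ) :
    |(Real.cos (scaledAngle x₀ τ n) - Real.cos (scaledAngle x₀ σ n)) /
      (scaledAngle x₀ τ n - scaledAngle x₀ σ n) + Real.sin (Real.arccos x₀)| ≤
        M / (2 * ε) / n := by
  have hd := h.scaledAngle_sub_ne_zero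
  have h1 := (convex_uIcc (scaledAngle x₀ σ n) (scaledAngle x₀ τ n)).norm_image_sub_le_of_norm_hasDerivWithin_le
    (f := fun θ => Real.cos θ + Real.sin (Real.arccos x₀) * θ)
    (f' := fun θ => -Real.sin θ + Real.sin (Real.arccos x₀) * 1) (C := M / (2 * ε) / n)
    (fun θ _ => ((Real.hasDerivAt_cos θ).add
      ((hasDerivAt_id θ).const_mul _)).hasDerivWithinAt)
    (fun θ hθ => by
      have := (h.between hθ).abs_sin_sub
      rw [← abs_neg] at this
      rw [Real.norm_eq_abs]
      convert this using 2
      ring)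
    Set.left_mem_uIcc Set.right_mem_uIcc
  rw [Real.norm_eq_abs, Real.norm_eq_abs] at h1
  refine le_of_mul_le_mul_right ?_ (abs_pos.2 hd)
  rw [← abs_mul]
  refine le_trans (le_of_eq ?_) h1
  congr 1
  field_simp
  ring

theorem abs_amplitude_sq_sub (h : BulkRegime ε M n x₀ σ τ) :
    |(Real.sin (Real.arccos x₀) ^ 2 * angleFun (n + 1) (scaledAngle x₀ σ n) ^ 2 +
        angleDeriv (n + 1) (scaledAngle x₀ σ n) ^ 2) * bulkScale n -
      √(2 / Real.pi) * Real.sin (Real.arccos x₀)| ≤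
      (M / (2 * ε) * (90 / ε ^ 2) + 84 / (ε / 2) ^ 4 + 2) * (1 / n) := by
  have hε := h.pos
  obtain ⟨hc0, -, hc1⟩ := sin_arccos_bounds h.pos h.mem
  have hn := h.cast_pos
  have hK : 0 ≤ M / (2 * ε) := div_nonneg h.bound_nonneg (by linarith [h.pos])
  have hdiff := h.left.abs_sin_sub
  have hs := h.left.sin_ge
  have hs0 : 0 < Real.sin (scaledAngle x₀ σ n) := by linarith
  obtain ⟨hYD, hZD⟩ := h.amplitude h.left
  have hen := h.energy h.left
  have hl := bulkScale_pos n
  have hlD := bulkScale_mul_bulkAmp_sq_le hε h.one_le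
  have hlB := bulkScale_mul_adiabatic_le h.one_le
  have hlB' := bulkScale_mul_adiabatic_sub_le h.one_le
  have hB := adiabatic_nonneg (n + 1)
  rw [angEnergy] at hen
  set c := Real.sin (Real.arccos x₀)
  set s := Real.sin (scaledAngle x₀ σ n)
  set Y := angleFun (n + 1) (scaledAngle x₀ σ n)
  set Z := angleDeriv (n + 1) (scaledAngle x₀ σ n)
  set D := bulkAmp ε n
  set B := adiabatic (n + 1)
  set l := bulkScale n
  have hY2 : Y ^ 2 ≤ D ^ 2 := sq_le_sq' (by linarith [(abs_le.1 hYD).1]) (abs_le.1 hYD).2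
  have hZ2 : Z ^ 2 ≤ D ^ 2 := sq_le_sq' (by linarith [(abs_le.1 hZD).1]) (abs_le.1 hZD).2
  have e1 : |(c - s) * (c * Y ^ 2 - Z ^ 2 / s) * l| ≤
      M / (2 * ε) / n * (90 / ε ^ 2) := by
    have h1 : |c * Y ^ 2 - Z ^ 2 / s| ≤ 3 / ε * D ^ 2 := by
      have h2 : c * Y ^ 2 ≤ 1 * D ^ 2 := by gcongr
      have h3 : Z ^ 2 / s ≤ D ^ 2 / (ε / 2) := by gcongr
      have h4 : 0 ≤ c * Y ^ 2 := mul_nonneg (hε.le.trans hc0) (sq_nonneg _)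
      have h5 : 0 ≤ Z ^ 2 / s := by positivity
      have h6 : D ^ 2 / (ε / 2) = 2 / ε * D ^ 2 := by field_simp
      have h7 : 3 / ε * D ^ 2 = 1 / ε * D ^ 2 + 2 / ε * D ^ 2 := by ring
      have h8 : 1 * D ^ 2 ≤ 1 / ε * D ^ 2 := by
        gcongr
        rw [le_div_iff₀ hε]
        linarith [h.le_half]
      have h9 : 0 ≤ 2 / ε * D ^ 2 := by positivity
      have h10 : 0 ≤ 1 / ε * D ^ 2 := by positivity
      rw [abs_le]
      constructor <;> linarith
    rw [abs_mul, abs_mul, abs_of_pos hl, mul_assoc, abs_sub_comm c s]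
    gcongr
    calc |c * Y ^ 2 - Z ^ 2 / s| * l ≤ 3 / ε * D ^ 2 * l := by gcongr
      _ = 3 / ε * (l * D ^ 2) := by ring
      _ ≤ 3 / ε * (30 / ε) := by gcongr
      _ = 90 / ε ^ 2 := by field_simp; norm_num
  have e2 : |c * (Z ^ 2 / s + s * Y ^ 2 - B) * l| ≤ 84 / (ε / 2) ^ 4 * (1 / n) := by
    rw [abs_mul, abs_mul, abs_of_pos hl, abs_of_pos (hε.trans_le hc0)]
    calc _ ≤ 1 * (28 / (ε / 2) ^ 4 / (2 * ((n + 1 : ℕ) : ℝ) + 1) * B) * l := by gcongr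
      _ = 28 / (ε / 2) ^ 4 / (2 * ((n + 1 : ℕ) : ℝ) + 1) * (l * B) := by ring
      _ ≤ 28 / (ε / 2) ^ 4 / n * 3 := by
        gcongr
        push_cast
        linarith
      _ = _ := by ring
  have e3 : |c * (l * B - √(2 / Real.pi))| ≤ 2 * (1 / n) := by
    rw [abs_mul, abs_of_pos (hε.trans_le hc0)]
    calc _ ≤ 1 * (2 / (n : ℝ)) := by gcongr
      _ = _ := by ring
  -- Three errors: freezing the sine, replacing the energy by its value at $\pi/2$, and replacing
  -- that value by its Wallis limit.
  have hdec : (c ^ 2 * Y ^ 2 + Z ^ 2) * l - √(2 / Real.pi) * c =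
      (c - s) * (c * Y ^ 2 - Z ^ 2 / s) * l + c * (Z ^ 2 / s + s * Y ^ 2 - B) * l +
        c * (l * B - √(2 / Real.pi)) := by
    field_simp
    ring
  rw [hdec]
  calc _ ≤ _ := (abs_add_le _ _).trans (add_le_add_left (abs_add_le _ _) _)
    _ ≤ M / (2 * ε) / n * (90 / ε ^ 2) + 84 / (ε / 2) ^ 4 * (1 / n) + 2 * (1 / n) := by
      gcongr
    _ = _ := by ring

end BulkRegime

/-! ### Limits of the factors of the kernel, uniformly in the parameters. -/

section Asymptotic

variable {ε M : ℝ}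

theorem isBigO_inv_of_regime {g : ℕ × ℝ × ℝ × ℝ → ℝ} (hε : 0 < ε) (C : ℝ)
    (h : ∀ p : ℕ × ℝ × ℝ × ℝ, BulkRegime ε M p.1 p.2.1 p.2.2.1 p.2.2.2 → |g p| ≤ C * (1 / p.1)) :
    g =O[bulk ε M] fun p => 1 / (p.1 : ℝ) := by
  refine IsBigO.of_bound C ((eventually_bulkRegime hε M).mono fun p hp => ?_)
  have h1 : (0 : ℝ) ≤ 1 / p.1 := by positivity
  rw [Real.norm_eq_abs, Real.norm_eq_abs, abs_of_nonneg h1]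
  exact h p hp

theorem isBigO_one_of_regime {g : ℕ × ℝ × ℝ × ℝ → ℝ} (hε : 0 < ε) (C : ℝ)
    (h : ∀ p : ℕ × ℝ × ℝ × ℝ, BulkRegime ε M p.1 p.2.1 p.2.2.1 p.2.2.2 → |g p| ≤ C) :
    g =O[bulk ε M] (1 : ℕ × ℝ × ℝ × ℝ → ℝ) :=
  isBigO_one_of_abs_le ((eventually_bulkRegime hε M).mono fun p hp => h p hp)

/-- The sine of `arccos x₀`. -/
def baseSin (p : ℕ × ℝ × ℝ × ℝ) : ℝ := Real.sin (Real.arccos p.2.1)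

/-- The angle with parameter `σ`. -/
def leftAngle (p : ℕ × ℝ × ℝ × ℝ) : ℝ := scaledAngle p.2.1 p.2.2.1 p.1

/-- The angle with parameter `τ`. -/
def rightAngle (p : ℕ × ℝ × ℝ × ℝ) : ℝ := scaledAngle p.2.1 p.2.2.2 p.1

/-- The Wronskian of the Hermite function at the two angles. -/
def angleWronskian (p : ℕ × ℝ × ℝ × ℝ) : ℝ :=
  angleDeriv (p.1 + 1) (leftAngle p) * angleFun (p.1 + 1) (rightAngle p) -
    angleFun (p.1 + 1) (leftAngle p) * angleDeriv (p.1 + 1) (rightAngle p)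

/-- The squared amplitude with frozen frequency. -/
def amplitudeSq (p : ℕ × ℝ × ℝ × ℝ) : ℝ :=
  baseSin p ^ 2 * angleFun (p.1 + 1) (leftAngle p) ^ 2 + angleDeriv (p.1 + 1) (leftAngle p) ^ 2

/-- The normalized Wronskian. -/
def scaledWronskian (p : ℕ × ℝ × ℝ × ℝ) : ℝ :=
  baseSin p * angleWronskian p / (rightAngle p - leftAngle p) *
    (bulkScale p.1 / (2 * ((p.1 + 1 : ℕ) : ℝ) + 1))

theorem sin_eq_mul_sinc (x : ℝ) : Real.sin x = x * Real.sinc x := by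
  by_cases hx : x = 0
  · simp [hx]
  · rw [Real.sinc_of_ne_zero hx]; field_simp

theorem scaledWronskian_add_isBigO (hε : 0 < ε) :
    (fun p => scaledWronskian p + amplitudeSq p * bulkScale p.1 * (baseSin p ^ 2 *
      Real.sinc ((2 * ((p.1 + 1 : ℕ) : ℝ) + 1) * baseSin p ^ 2 * (rightAngle p - leftAngle p))))
      =O[bulk ε M] fun p => 1 / (p.1 : ℝ) := by
  refine isBigO_inv_of_regime hε (80 * (M / (2 * ε)) * (30 / ε)) fun p hp => ?_
  have h1 := hp.wronskian
  have hd : rightAngle p - leftAngle p ≠ 0 := hp.scaledAngle_sub_ne_zero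
  have hn := hp.cast_pos
  have hL : (0 : ℝ) < 2 * ((p.1 + 1 : ℕ) : ℝ) + 1 := by positivity
  have hl := bulkScale_pos p.1
  have hK : 0 ≤ M / (2 * ε) := div_nonneg hp.bound_nonneg (by linarith [hp.pos])
  change |baseSin p * angleWronskian p + amplitudeSq p * Real.sin ((2 * ((p.1 + 1 : ℕ) : ℝ) + 1) *
    baseSin p ^ 2 * (rightAngle p - leftAngle p))| ≤ 16 * (5 * (M / (2 * ε))) * bulkAmp ε p.1 ^ 2 *
        |rightAngle p - leftAngle p| at h1
  rw [sin_eq_mul_sinc] at h1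
  have h2 : scaledWronskian p + amplitudeSq p * bulkScale p.1 * (baseSin p ^ 2 *
      Real.sinc ((2 * ((p.1 + 1 : ℕ) : ℝ) + 1) * baseSin p ^ 2 * (rightAngle p - leftAngle p))) =
      (baseSin p * angleWronskian p + amplitudeSq p * ((2 * ((p.1 + 1 : ℕ) : ℝ) + 1) *
        baseSin p ^ 2 * (rightAngle p - leftAngle p) * Real.sinc ((2 * ((p.1 + 1 : ℕ) : ℝ) + 1) *
          baseSin p ^ 2 * (rightAngle p - leftAngle p)))) / (rightAngle p - leftAngle p) *
        (bulkScale p.1 / (2 * ((p.1 + 1 : ℕ) : ℝ) + 1)) := by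
    rw [scaledWronskian]
    field_simp
  rw [h2, abs_mul, abs_div, abs_of_pos (by positivity :
    0 < bulkScale p.1 / (2 * ((p.1 + 1 : ℕ) : ℝ) + 1))]
  have h3 := (div_le_iff₀ (abs_pos.2 hd)).2 h1
  calc _ ≤ 16 * (5 * (M / (2 * ε))) * bulkAmp ε p.1 ^ 2 * (bulkScale p.1 / p.1) := by
        gcongr
        push_cast
        linarith
    _ = 80 * (M / (2 * ε)) * (bulkScale p.1 * bulkAmp ε p.1 ^ 2) * (1 / p.1) := by ring
    _ ≤ _ := by
        gcongr
        exact bulkScale_mul_bulkAmp_sq_le hε hp.one_le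

theorem abs_sinc_phase_sub_le {n : ℕ} {x₀ σ τ : ℝ} (h : BulkRegime ε M n x₀ σ τ) :
    |Real.sinc ((2 * ((n + 1 : ℕ) : ℝ) + 1) * Real.sin (Real.arccos x₀) ^ 2 *
      (scaledAngle x₀ τ n - scaledAngle x₀ σ n)) - Real.sinc (τ - σ)| ≤ 3 * M * (1 / n) := by
  refine (abs_sinc_sub_sinc_le _ _).trans ?_
  have hn := h.cast_pos
  have hc := (sin_arccos_bounds h.pos h.mem).2.1
  have hc0 : Real.sin (Real.arccos x₀) ≠ 0 := by
    intro h0; rw [h0] at hc; linarith [h.pos]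
  -- The phase is $\frac{2n+3}{2n}(\tau-\sigma)$: the factor $\sin^2\phi$ cancels against the
  -- scaling of the points.
  have h1 : (2 * ((n + 1 : ℕ) : ℝ) + 1) * Real.sin (Real.arccos x₀) ^ 2 *
      (scaledAngle x₀ τ n - scaledAngle x₀ σ n) - (τ - σ) = 3 / 2 * (τ - σ) * (1 / n) := by
    rw [h.scaledAngle_sub]
    push_cast
    field_simp
    ring
  rw [h1, abs_mul, abs_mul, abs_of_pos (by positivity : (0 : ℝ) < 1 / n),
    abs_of_pos (by norm_num : (0 : ℝ) < 3 / 2)]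
  have h2 := abs_sub τ σ
  have h3 : 3 / 2 * |τ - σ| ≤ 3 * M := by linarith [h.left_le, h.right_le]
  gcongr

theorem isBigO_inv_natCast_one (hε : 0 < ε) :
    (fun p : ℕ × ℝ × ℝ × ℝ => 1 / (p.1 : ℝ)) =O[bulk ε M] (1 : ℕ × ℝ × ℝ × ℝ → ℝ) := by
  refine isBigO_one_of_regime hε 1 fun p hp => ?_
  have hn := hp.cast_pos
  rw [abs_of_pos (by positivity), div_le_one hn]
  exact_mod_cast hp.one_le

theorem scaledWronskian_sub_isBigO (hε : 0 < ε) :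
    (fun p => scaledWronskian p - -(√(2 / Real.pi) * baseSin p * (baseSin p ^ 2 *
      Real.sinc (p.2.2.2 - p.2.2.1)))) =O[bulk ε M] fun p => 1 / (p.1 : ℝ) := by
  have h1 : (fun p => amplitudeSq p * bulkScale p.1 - √(2 / Real.pi) * baseSin p)
      =O[bulk ε M] fun p => 1 / (p.1 : ℝ) :=
    isBigO_inv_of_regime hε _ fun p hp => hp.abs_amplitude_sq_sub
  have h2 : (fun p => baseSin p ^ 2 * Real.sinc ((2 * ((p.1 + 1 : ℕ) : ℝ) + 1) * baseSin p ^ 2 *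
      (rightAngle p - leftAngle p)) - baseSin p ^ 2 * Real.sinc (p.2.2.2 - p.2.2.1))
      =O[bulk ε M] fun p => 1 / (p.1 : ℝ) := by
    refine isBigO_inv_of_regime hε (3 * M) fun p hp => ?_
    rw [← mul_sub, abs_mul]
    refine (mul_le_of_le_one_left (abs_nonneg _) ?_).trans (abs_sinc_phase_sub_le hp)
    rw [abs_of_nonneg (sq_nonneg _)]
    exact Real.sin_sq_le_one _
  have h3 := isBigO_mul_sub_mul h1 h2
    (isBigO_one_of_regime hε 1 fun p hp => by
      rw [abs_mul, abs_of_nonneg (Real.sqrt_nonneg _)]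
      exact mul_le_one₀ sqrt_two_div_pi_le (abs_nonneg _) (Real.abs_sin_le_one _))
    (isBigO_one_of_regime hε 1 fun p hp => by
      rw [abs_mul, abs_of_nonneg (sq_nonneg _)]
      exact mul_le_one₀ (Real.sin_sq_le_one _) (abs_nonneg _) (Real.abs_sinc_le_one _))
    (isBigO_inv_natCast_one hε)
  exact ((scaledWronskian_add_isBigO hε).sub h3).congr_left fun p => by ring

theorem cos_mul_cos_inv_isBigO (hε : 0 < ε) :
    (fun p => (Real.cos (leftAngle p) * Real.cos (rightAngle p))⁻¹ - (p.2.1 * p.2.1)⁻¹)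
      =O[bulk ε M] fun p => 1 / (p.1 : ℝ) := by
  have h1 : ∀ p : ℕ × ℝ × ℝ × ℝ, BulkRegime ε M p.1 p.2.1 p.2.2.1 p.2.2.2 → |p.2.1| ≤ 1 := by
    intro p hp
    rw [abs_le]
    constructor <;> linarith [hp.mem.1, hp.mem.2]
  refine isBigO_inv_sub_inv (δ := ε / 2 * (ε / 2)) (by positivity)
    ((eventually_bulkRegime hε M).mono fun p hp => ?_)
    ((eventually_bulkRegime hε M).mono fun p hp => ?_)
    (isBigO_mul_sub_mul (isBigO_inv_of_regime hε (M / (2 * ε)) fun p hp => ?_)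
      (isBigO_inv_of_regime hε (M / (2 * ε)) fun p hp => ?_) (isBigO_one_of_regime hε 1 h1)
      (isBigO_one_of_regime hε 1 h1) (isBigO_inv_natCast_one hε))
  · have h2 : ε / 2 ≤ Real.cos (leftAngle p) := hp.left.cos_ge
    have h3 : ε / 2 ≤ Real.cos (rightAngle p) := hp.right.cos_ge
    refine le_trans ?_ (le_abs_self _)
    exact mul_le_mul h2 h3 (half_pos hε).le ((half_pos hε).le.trans h2)
  · have := hp.mem.1
    refine le_trans ?_ (le_abs_self _)
    gcongr <;> linarith
  · rw [mul_one_div]; exact hp.left.abs_cos_sub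
  · rw [mul_one_div]; exact hp.right.abs_cos_sub

/-- The slope of the cosine between the two angles. -/
def cosSlope (p : ℕ × ℝ × ℝ × ℝ) : ℝ :=
  (Real.cos (rightAngle p) - Real.cos (leftAngle p)) / (rightAngle p - leftAngle p)

theorem half_le_abs_cosSlope {p : ℕ × ℝ × ℝ × ℝ}
    (hp : BulkRegime ε M p.1 p.2.1 p.2.2.1 p.2.2.2) : ε / 2 ≤ |cosSlope p| := by
  have h1 : |cosSlope p + baseSin p| ≤ _ := hp.abs_cos_slope_add
  have h2 : ε ≤ baseSin p := (sin_arccos_bounds hp.pos hp.mem).1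
  have h3 := (abs_le.1 (h1.trans hp.small)).2
  have h4 := neg_le_abs (cosSlope p)
  linarith

theorem cosSlope_inv_isBigO (hε : 0 < ε) :
    (fun p => (cosSlope p)⁻¹ - (-baseSin p)⁻¹) =O[bulk ε M] fun p => 1 / (p.1 : ℝ) := by
  refine isBigO_inv_sub_inv (δ := ε / 2) (by positivity)
    ((eventually_bulkRegime hε M).mono fun p hp => half_le_abs_cosSlope hp)
    ((eventually_bulkRegime hε M).mono fun p hp => ?_)
    (isBigO_inv_of_regime hε (M / (2 * ε)) fun p hp => ?_)
  · have h2 : ε ≤ baseSin p := (sin_arccos_bounds hp.pos hp.mem).1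
    rw [abs_neg]
    linarith [le_abs_self (baseSin p)]
  · rw [sub_neg_eq_add, mul_one_div]; exact hp.abs_cos_slope_add

/-- For odd $n$ each factor is of size `bulkScale n` times the amplitude, and the denominator $n+2$
absorbs the square of the scale. -/
theorem abs_kernelRem_le {n : ℕ} {x₀ σ τ : ℝ} (h : BulkRegime ε M n x₀ σ τ) :
    |kernelRem n (rescaledPoint x₀ σ n) (rescaledPoint x₀ τ n)| ≤ 4 * bulkAmp ε n ^ 2 := by
  have hl := bulkScale_pos n
  have hl2 := bulkScale_sq n
  have hY : ∀ ρ, hermiteFun (n + 1) (rescaledPoint x₀ ρ n) =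
      angleFun (n + 1) (scaledAngle x₀ ρ n) := by
    intro ρ; rw [rescaledPoint_eq]; rfl
  have hZ : ∀ ρ, hermiteFunDeriv (n + 1) (rescaledPoint x₀ ρ n) =
      bulkScale n * angleDeriv (n + 1) (scaledAngle x₀ ρ n) := by
    intro ρ
    rw [rescaledPoint_eq, angleDeriv]
    exact (mul_div_cancel₀ _ hl.ne').symm
  have hb : ∀ ρ, |angleFun (n + 1) (scaledAngle x₀ ρ n)| ≤ bulkAmp ε n →
      |angleDeriv (n + 1) (scaledAngle x₀ ρ n)| ≤ bulkAmp ε n →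
      |rescaledPoint x₀ ρ n / 2 * angleFun (n + 1) (scaledAngle x₀ ρ n) -
        bulkScale n * angleDeriv (n + 1) (scaledAngle x₀ ρ n)| ≤
          bulkScale n * (2 * bulkAmp ε n) := by
    intro ρ h1 h2
    have e : rescaledPoint x₀ ρ n / 2 * angleFun (n + 1) (scaledAngle x₀ ρ n) -
        bulkScale n * angleDeriv (n + 1) (scaledAngle x₀ ρ n) = bulkScale n *
          (Real.cos (scaledAngle x₀ ρ n) * angleFun (n + 1) (scaledAngle x₀ ρ n) -
            angleDeriv (n + 1) (scaledAngle x₀ ρ n)) := by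
      rw [rescaledPoint_eq]; ring
    rw [e, abs_mul, abs_of_pos hl]
    gcongr
    refine (abs_sub _ _).trans ?_
    rw [abs_mul]
    have := mul_le_of_le_one_left (abs_nonneg (angleFun (n + 1) (scaledAngle x₀ ρ n)))
      (Real.abs_cos_le_one (scaledAngle x₀ ρ n))
    linarith
  obtain ⟨hY1, hZ1⟩ := h.amplitude h.left
  obtain ⟨hY2, hZ2⟩ := h.amplitude h.right
  have hD : 0 ≤ bulkAmp ε n := Real.sqrt_nonneg _
  rw [kernelRem]
  split_ifs
  · rw [hY, hY, abs_mul]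
    calc _ ≤ bulkAmp ε n * bulkAmp ε n := by gcongr
      _ ≤ _ := by nlinarith
  · rw [hY, hY, hZ, hZ, abs_div, abs_mul, abs_of_pos (by positivity : (0 : ℝ) < n + 2),
      div_le_iff₀ (by positivity)]
    calc _ ≤ (bulkScale n * (2 * bulkAmp ε n)) * (bulkScale n * (2 * bulkAmp ε n)) := by
          gcongr
          · exact hb σ hY1 hZ1
          · exact hb τ hY2 hZ2
      _ = bulkScale n ^ 2 * (4 * bulkAmp ε n ^ 2) := by ring
      _ ≤ (n + 2) * (4 * bulkAmp ε n ^ 2) := by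
          rw [hl2]
          gcongr
          linarith
      _ = _ := by ring

/-- The lower order part of the rescaled kernel. -/
def scaledRem (p : ℕ × ℝ × ℝ × ℝ) : ℝ :=
  2 * bulkScale p.1 * (2 * Real.pi) ^ (-(3 / 2) : ℝ) *
    (angleFun (p.1 + 1) (leftAngle p) * angleFun (p.1 + 1) (rightAngle p) / 2 /
        (rescaledPoint p.2.1 p.2.2.1 p.1 * rescaledPoint p.2.1 p.2.2.2 p.1) -
      kernelRem p.1 (rescaledPoint p.2.1 p.2.2.1 p.1) (rescaledPoint p.2.1 p.2.2.2 p.1) /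
        (rescaledPoint p.2.1 p.2.2.1 p.1 ^ 2 * rescaledPoint p.2.1 p.2.2.2 p.1 ^ 2))

theorem rescaledPoint_ge {n : ℕ} {x₀ σ τ : ℝ} (h : BulkRegime ε M n x₀ σ τ) :
    bulkScale n * ε ≤ rescaledPoint x₀ σ n := by
  rw [rescaledPoint_eq]
  have := h.left.cos_ge
  have hl := bulkScale_pos n
  nlinarith

theorem two_pi_rpow_le_one : (2 * Real.pi) ^ (-(3 / 2) : ℝ) ≤ 1 :=
  Real.rpow_le_one_of_one_le_of_nonpos (by linarith [Real.pi_gt_three]) (by norm_num)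

/-- The points are at least $\varepsilon$ times the scale $l$, with $l^2\ge n$, so division by $st$
gains $1/n$, while $l$ times the squared amplitude stays bounded. -/
theorem scaledRem_isBigO (hε : 0 < ε) : scaledRem =O[bulk ε M] fun p => 1 / (p.1 : ℝ) := by
  refine isBigO_inv_of_regime hε (2 * (1 / ε ^ 2 + 4 / ε ^ 4) * (30 / ε)) fun p hp => ?_
  have hn := hp.cast_pos
  have hn1 : (1 : ℝ) ≤ p.1 := by exact_mod_cast hp.one_le
  have hl := bulkScale_pos p.1
  have hl2 := bulkScale_sq p.1
  have hR := abs_kernelRem_le hp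
  obtain ⟨hY1, -⟩ := hp.amplitude hp.left
  obtain ⟨hY2, -⟩ := hp.amplitude hp.right
  have hs := rescaledPoint_ge hp
  have ht := rescaledPoint_ge hp.symm
  have hlD := bulkScale_mul_bulkAmp_sq_le hε hp.one_le
  have hD : 0 ≤ bulkAmp ε p.1 := Real.sqrt_nonneg _
  have hpi := two_pi_rpow_le_one
  rw [scaledRem]
  change |angleFun (p.1 + 1) (leftAngle p)| ≤ _ at hY1
  change |angleFun (p.1 + 1) (rightAngle p)| ≤ _ at hY2
  set s := rescaledPoint p.2.1 p.2.2.1 p.1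
  set t := rescaledPoint p.2.1 p.2.2.2 p.1
  set D := bulkAmp ε p.1
  set l := bulkScale p.1
  have hlε : 0 < l * ε := by positivity
  have hs0 : 0 < s := hlε.trans_le hs
  have ht0 : 0 < t := hlε.trans_le ht
  have hln : (p.1 : ℝ) ≤ l ^ 2 := by linarith
  have e1 : |angleFun (p.1 + 1) (leftAngle p) * angleFun (p.1 + 1) (rightAngle p) / 2 / (s * t)| ≤
      1 / ε ^ 2 * D ^ 2 * (1 / p.1) := by
    rw [abs_div, abs_div, abs_mul, abs_of_pos (by positivity : 0 < s * t), abs_two]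
    calc _ ≤ D * D / 1 / ((l * ε) * (l * ε)) := by gcongr; norm_num
      _ = 1 / ε ^ 2 * D ^ 2 * (1 / l ^ 2) := by field_simp
      _ ≤ _ := by gcongr
  have e2 : |kernelRem p.1 s t / (s ^ 2 * t ^ 2)| ≤ 4 / ε ^ 4 * D ^ 2 * (1 / p.1) := by
    rw [abs_div, abs_of_pos (by positivity : 0 < s ^ 2 * t ^ 2)]
    calc _ ≤ 4 * D ^ 2 / ((l * ε) ^ 2 * (l * ε) ^ 2) := by gcongr
      _ = 4 / ε ^ 4 * D ^ 2 * (1 / (l ^ 2 * l ^ 2)) := by field_simp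
      _ ≤ _ := by
        gcongr
        nlinarith
  rw [abs_mul, abs_of_nonneg (by positivity)]
  calc _ ≤ 2 * l * 1 * (1 / ε ^ 2 * D ^ 2 * (1 / p.1) + 4 / ε ^ 4 * D ^ 2 * (1 / p.1)) := by
        gcongr
        exact (abs_sub _ _).trans (add_le_add e1 e2)
    _ = 2 * (1 / ε ^ 2 + 4 / ε ^ 4) * (l * D ^ 2) * (1 / p.1) := by ring
    _ ≤ _ := by gcongr

/-- The rescaled kernel. -/
def scaledKernel (p : ℕ × ℝ × ℝ × ℝ) : ℝ :=
  2 * √((p.1 : ℝ) + 3 / 2) *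
    rhoN p.1 (rescaledPoint p.2.1 p.2.2.1 p.1) (rescaledPoint p.2.1 p.2.2.2 p.1) *
    √(f (rescaledPoint p.2.1 p.2.2.1 p.1) * f (rescaledPoint p.2.1 p.2.2.2 p.1))

theorem scaledKernel_eq {p : ℕ × ℝ × ℝ × ℝ} (hp : BulkRegime ε M p.1 p.2.1 p.2.2.1 p.2.2.2) :
    scaledKernel p = (2 * Real.pi) ^ (-(3 / 2) : ℝ) / 2 *
      ((Real.cos (leftAngle p) * Real.cos (rightAngle p))⁻¹ *
        (((cosSlope p)⁻¹ * (baseSin p)⁻¹) * scaledWronskian p)) + scaledRem p := by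
  have hl := bulkScale_pos p.1
  have hl2 := bulkScale_sq p.1
  have hlε : 0 < bulkScale p.1 * ε := mul_pos hl hp.pos
  have hs0 : 0 < rescaledPoint p.2.1 p.2.2.1 p.1 := hlε.trans_le (rescaledPoint_ge hp)
  have ht0 : 0 < rescaledPoint p.2.1 p.2.2.2 p.1 := hlε.trans_le (rescaledPoint_ge hp.symm)
  have hd : rightAngle p - leftAngle p ≠ 0 := hp.scaledAngle_sub_ne_zero
  have hslope := half_le_abs_cosSlope hp
  have hslope0 : cosSlope p ≠ 0 := by
    rw [← abs_pos]; linarith [hp.pos]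
  have hdc : Real.cos (rightAngle p) - Real.cos (leftAngle p) ≠ 0 := by
    intro h0; exact hslope0 (by rw [cosSlope, h0, zero_div])
  have hc0 : baseSin p ≠ 0 := by
    have h2 : ε ≤ baseSin p := (sin_arccos_bounds hp.pos hp.mem).1
    linarith [hp.pos]
  have hcl : 0 < Real.cos (leftAngle p) := (half_pos hp.pos).trans_le hp.left.cos_ge
  have hcr : 0 < Real.cos (rightAngle p) := (half_pos hp.pos).trans_le hp.right.cos_ge
  have hsl : rescaledPoint p.2.1 p.2.2.1 p.1 = 2 * bulkScale p.1 * Real.cos (leftAngle p) :=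
    rescaledPoint_eq _ _ _
  have htr : rescaledPoint p.2.1 p.2.2.2 p.1 = 2 * bulkScale p.1 * Real.cos (rightAngle p) :=
    rescaledPoint_eq _ _ _
  have hne : rescaledPoint p.2.1 p.2.2.1 p.1 ≠ rescaledPoint p.2.1 p.2.2.2 p.1 := by
    rw [hsl, htr]
    intro h0
    exact hdc (sub_eq_zero.2 (mul_left_cancel₀ (by positivity) h0).symm)
  have hL : 2 * ((p.1 + 1 : ℕ) : ℝ) + 1 = 2 * bulkScale p.1 ^ 2 := by
    rw [hl2]; push_cast; ring
  have hsq : √((p.1 : ℝ) + 3 / 2) = bulkScale p.1 := by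
    rw [← hl2, Real.sqrt_sq hl.le]
  have hYl : hermiteFun (p.1 + 1) (rescaledPoint p.2.1 p.2.2.1 p.1) =
      angleFun (p.1 + 1) (leftAngle p) := by rw [hsl]; rfl
  have hYr : hermiteFun (p.1 + 1) (rescaledPoint p.2.1 p.2.2.2 p.1) =
      angleFun (p.1 + 1) (rightAngle p) := by rw [htr]; rfl
  have hZl : hermiteFunDeriv (p.1 + 1) (rescaledPoint p.2.1 p.2.2.1 p.1) =
      bulkScale p.1 * angleDeriv (p.1 + 1) (leftAngle p) := by
    rw [hsl]; exact (mul_div_cancel₀ _ hl.ne').symm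
  have hZr : hermiteFunDeriv (p.1 + 1) (rescaledPoint p.2.1 p.2.2.2 p.1) =
      bulkScale p.1 * angleDeriv (p.1 + 1) (rightAngle p) := by
    rw [htr]; exact (mul_div_cancel₀ _ hl.ne').symm
  have hker := rhoN_eq_wronskian p.1 hs0.ne' ht0.ne' hne
  rw [hYl, hYr, hZl, hZr] at hker
  have h1 : scaledKernel p = 2 * bulkScale p.1 * (2 * Real.pi) ^ (-(3 / 2) : ℝ) *
      (rhoN p.1 (rescaledPoint p.2.1 p.2.2.1 p.1) (rescaledPoint p.2.1 p.2.2.2 p.1) *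
        (Real.exp (-rescaledPoint p.2.1 p.2.2.1 p.1 ^ 2 / 4) *
          Real.exp (-rescaledPoint p.2.1 p.2.2.2 p.1 ^ 2 / 4))) := by
    rw [scaledKernel, sqrt_f_mul_f, hsq]; ring
  rw [h1, hker, scaledRem]
  have h2 : bulkScale p.1 * angleDeriv (p.1 + 1) (leftAngle p) *
      angleFun (p.1 + 1) (rightAngle p) - angleFun (p.1 + 1) (leftAngle p) *
        (bulkScale p.1 * angleDeriv (p.1 + 1) (rightAngle p)) =
      bulkScale p.1 * angleWronskian p := by rw [angleWronskian]; ring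
  rw [h2]
  have h3 : 2 * bulkScale p.1 * (1 / (rescaledPoint p.2.1 p.2.2.1 p.1 *
      rescaledPoint p.2.1 p.2.2.2 p.1) * (bulkScale p.1 * angleWronskian p /
        (rescaledPoint p.2.1 p.2.2.2 p.1 - rescaledPoint p.2.1 p.2.2.1 p.1))) =
      1 / 2 * ((Real.cos (leftAngle p) * Real.cos (rightAngle p))⁻¹ *
        (((cosSlope p)⁻¹ * (baseSin p)⁻¹) * scaledWronskian p)) := by
    rw [scaledWronskian, hL, cosSlope, hsl, htr, ← mul_sub]
    field_simp
  linear_combination (2 * Real.pi) ^ (-(3 / 2) : ℝ) * h3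

/-- The normalization of $f$ and the Wallis constant combine into the constant of the limiting
density. -/
theorem two_pi_rpow_mul : (2 * Real.pi) ^ (-(3 / 2) : ℝ) / 2 * √(2 / Real.pi) =
    1 / (2 * Real.pi) ^ 2 := by
  have hpi := Real.pi_pos
  have h1 : √(2 / Real.pi) = 2 * (2 * Real.pi) ^ (-(1 / 2) : ℝ) := by
    rw [Real.rpow_neg (by positivity), ← Real.sqrt_eq_rpow,
      show 2 / Real.pi = 2 ^ 2 / (2 * Real.pi) by field_simp, Real.sqrt_div (by positivity),
      Real.sqrt_sq two_pos.le, div_eq_mul_inv]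
  rw [h1, div_mul_eq_mul_div, mul_left_comm, mul_div_cancel_left₀ _ two_ne_zero,
    ← Real.rpow_add (by positivity), show (-(3 / 2) + -(1 / 2) : ℝ) = -(2 : ℕ) by norm_num,
    Real.rpow_neg (by positivity), Real.rpow_natCast, one_div]

theorem scaledKernel_sub_isBigO (hε : 0 < ε) :
    (fun p => scaledKernel p - Real.sinc (p.2.2.2 - p.2.2.1) * rho p.2.1)
      =O[bulk ε M] fun p => 1 / (p.1 : ℝ) := by
  have hone := isBigO_inv_natCast_one (M := M) hε
  have hinv : (fun p => (baseSin p)⁻¹) =O[bulk ε M] (1 : ℕ × ℝ × ℝ × ℝ → ℝ) := by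
    refine isBigO_one_of_regime hε ε⁻¹ fun p hp => ?_
    have h2 : ε ≤ baseSin p := (sin_arccos_bounds hp.pos hp.mem).1
    rw [abs_inv]
    exact inv_anti₀ hε (h2.trans (le_abs_self _))
  have hneg : (fun p => (-baseSin p)⁻¹) =O[bulk ε M] (1 : ℕ × ℝ × ℝ × ℝ → ℝ) :=
    hinv.neg_left.congr_left fun p => by rw [inv_neg]
  have hx : (fun p : ℕ × ℝ × ℝ × ℝ => (p.2.1 * p.2.1)⁻¹) =O[bulk ε M] (1 : ℕ × ℝ × ℝ × ℝ → ℝ) := by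
    refine isBigO_one_of_regime hε (ε * ε)⁻¹ fun p hp => ?_
    have := hp.mem.1
    rw [abs_inv]
    refine inv_anti₀ (by positivity) (le_trans ?_ (le_abs_self _))
    exact mul_le_mul this this hε.le (hε.le.trans this)
  have hw : (fun p => -(√(2 / Real.pi) * baseSin p * (baseSin p ^ 2 *
      Real.sinc (p.2.2.2 - p.2.2.1)))) =O[bulk ε M] (1 : ℕ × ℝ × ℝ × ℝ → ℝ) := by
    refine isBigO_one_of_regime hε 1 fun p hp => ?_
    rw [abs_neg, abs_mul, abs_mul, abs_mul, abs_of_nonneg (Real.sqrt_nonneg _),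
      abs_of_nonneg (sq_nonneg (baseSin p))]
    exact mul_le_one₀ (mul_le_one₀ sqrt_two_div_pi_le (abs_nonneg _) (Real.abs_sin_le_one _))
      (by positivity) (mul_le_one₀ (Real.sin_sq_le_one _) (abs_nonneg _) (Real.abs_sinc_le_one _))
  have hmul : ∀ {u v : ℕ × ℝ × ℝ × ℝ → ℝ}, u =O[bulk ε M] (1 : ℕ × ℝ × ℝ × ℝ → ℝ) →
      v =O[bulk ε M] (1 : ℕ × ℝ × ℝ × ℝ → ℝ) →
      (fun p => u p * v p) =O[bulk ε M] (1 : ℕ × ℝ × ℝ × ℝ → ℝ) := by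
    intro u v hu hv
    exact (hu.mul hv).congr_right fun p => by simp
  have hs : (fun p => (baseSin p)⁻¹ - (baseSin p)⁻¹) =O[bulk ε M] fun p => 1 / (p.1 : ℝ) := by
    simpa using isBigO_zero _ _
  have h1 := isBigO_mul_sub_mul (cosSlope_inv_isBigO (M := M) hε) hs hneg hinv hone
  have h2 := isBigO_mul_sub_mul h1 (scaledWronskian_sub_isBigO hε) (hmul hneg hinv) hw hone
  have h3 := isBigO_mul_sub_mul (cos_mul_cos_inv_isBigO (M := M) hε) h2 hx
    (hmul (hmul hneg hinv) hw) hone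
  refine ((h3.const_mul_left ((2 * Real.pi) ^ (-(3 / 2) : ℝ) / 2)).add
    (scaledRem_isBigO hε)).congr' ?_ EventuallyEq.rfl
  filter_upwards [eventually_bulkRegime hε M] with p hp
  have h2 : ε ≤ baseSin p := (sin_arccos_bounds hp.pos hp.mem).1
  have hc0 : baseSin p ≠ 0 := by linarith [hp.pos]
  have hx0 : p.2.1 ≠ 0 := by linarith [hp.pos, hp.mem.1]
  -- The minus signs of the cosine slope and of the Wronskian cancel, and
  -- $c^3/c^2=c=\sqrt{1-x_0^2}$.
  have hrho : Real.sinc (p.2.2.2 - p.2.2.1) * rho p.2.1 =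
      (2 * Real.pi) ^ (-(3 / 2) : ℝ) / 2 * ((p.2.1 * p.2.1)⁻¹ * ((-baseSin p)⁻¹ * (baseSin p)⁻¹ *
        -(√(2 / Real.pi) * baseSin p * (baseSin p ^ 2 * Real.sinc (p.2.2.2 - p.2.2.1))))) := by
    have h4 : √(1 - p.2.1 ^ 2) = baseSin p := (Real.sin_arccos _).symm
    rw [rho, h4, ← two_pi_rpow_mul]
    field_simp
  rw [scaledKernel_eq hp, hrho]
  ring

end Asymptotic

/-! ### The diagonal, small $n$, and the final bound. -/

/-- The deviation of the rescaled kernel from the sine kernel. -/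
def kernelError (n : ℕ) (x₀ σ τ : ℝ) : ℝ :=
  2 * √((n : ℝ) + 3 / 2) * rhoN n (rescaledPoint x₀ σ n) (rescaledPoint x₀ τ n) *
    √(f (rescaledPoint x₀ σ n) * f (rescaledPoint x₀ τ n)) - Real.sinc (τ - σ) * rho x₀

theorem exists_eventually_kernelError_le {ε : ℝ} (hε : 0 < ε) (M : ℝ) :
    ∃ C : ℝ, ∀ᶠ n : ℕ in atTop, ∀ x₀ ∈ Set.Icc ε (1 - ε), ∀ σ τ : ℝ, |σ| ≤ M → |τ| ≤ M → σ ≠ τ →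
      |kernelError n x₀ σ τ| ≤ C * (1 / n) := by
  obtain ⟨C, hC⟩ := (scaledKernel_sub_isBigO (M := M) hε).bound
  refine ⟨C, ?_⟩
  rw [← eventually_bulk (P := fun n x₀ σ τ => |kernelError n x₀ σ τ| ≤ C * (1 / n))]
  refine hC.mono fun p hp => ?_
  rw [Real.norm_eq_abs, Real.norm_eq_abs, abs_of_nonneg (by positivity : (0 : ℝ) ≤ 1 / p.1)] at hp
  exact hp

/-- The numerator vanishes at $t=s$, so the kernel and its diagonal value together form a divided
slope, which is continuous at the base point. -/
theorem rhoN_eq_dslope (n : ℕ) (s t : ℝ) :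
    rhoN n s t = dslope (fun x => (Q n).eval s * (Q (n + 1)).eval x -
      (Q (n + 1)).eval s * (Q n).eval x) s t / h n := by
  by_cases hst : s = t
  · subst hst
    have hd : HasDerivAt (fun x => (Q n).eval s * (Q (n + 1)).eval x -
        (Q (n + 1)).eval s * (Q n).eval x) _ s :=
      (((Q (n + 1)).hasDerivAt s).const_mul _).sub (((Q n).hasDerivAt s).const_mul _)
    rw [rhoN, if_pos rfl, dslope_same, hd.deriv]
  · rw [rhoN, if_neg hst, dslope_of_ne _ (Ne.symm hst), slope_def_field, mul_comm (h n),
      ← div_div]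
    congr 2
    ring

theorem continuousAt_rhoN (n : ℕ) (s : ℝ) : ContinuousAt (rhoN n s) s := by
  rw [funext (rhoN_eq_dslope n s)]
  refine (continuousAt_dslope_same.2 ?_).div_const _
  exact (((Q (n + 1)).differentiable.const_mul _).sub ((Q n).differentiable.const_mul _)) s

theorem continuous_rescaledPoint (x₀ : ℝ) (n : ℕ) :
    Continuous fun τ => rescaledPoint x₀ τ n := by
  unfold rescaledPoint
  fun_prop

theorem continuous_f : Continuous f := by
  unfold f
  fun_prop

theorem continuousAt_kernelError (n : ℕ) (x₀ σ : ℝ) :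
    ContinuousAt (fun τ => kernelError n x₀ σ τ) σ := by
  have hr := (continuous_rescaledPoint x₀ n).continuousAt (x := σ)
  have h1 : ContinuousAt (fun τ => rhoN n (rescaledPoint x₀ σ n) (rescaledPoint x₀ τ n)) σ :=
    ContinuousAt.comp (f := fun τ => rescaledPoint x₀ τ n)
      (g := rhoN n (rescaledPoint x₀ σ n)) (continuousAt_rhoN n _) hr
  have h2 : ContinuousAt (fun τ => √(f (rescaledPoint x₀ σ n) * f (rescaledPoint x₀ τ n))) σ :=
    (((continuous_f.comp (continuous_rescaledPoint x₀ n)).const_mul _).sqrt).continuousAt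
  have h3 : ContinuousAt (fun τ => Real.sinc (τ - σ)) σ :=
    (Real.continuous_sinc.comp (continuous_id.sub continuous_const)).continuousAt
  exact ((h1.const_mul _).mul h2).sub (h3.mul_const _)

/-- The diagonal value is the limit as $\tau\to\sigma$, $\tau\neq\sigma$. The margin $M+1$ leaves
room for a full neighbourhood when $|\sigma|=M$. -/
theorem kernelError_self_le {n : ℕ} {x₀ σ M C : ℝ} (hσ : |σ| ≤ M)
    (h : ∀ τ : ℝ, |τ| ≤ M + 1 → σ ≠ τ → |kernelError n x₀ σ τ| ≤ C) :
    |kernelError n x₀ σ σ| ≤ C := by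
  have h1 : Tendsto (fun τ => |kernelError n x₀ σ τ|) (𝓝[≠] σ) (𝓝 |kernelError n x₀ σ σ|) :=
    ((continuousAt_kernelError n x₀ σ).abs.tendsto).mono_left nhdsWithin_le_nhds
  refine le_of_tendsto h1 ?_
  have h2 : ∀ᶠ τ in 𝓝 σ, |τ| ≤ M + 1 :=
    continuous_abs.continuousAt.eventually_le_const (by linarith)
  filter_upwards [nhdsWithin_le_nhds h2, self_mem_nhdsWithin] with τ hτ hne
  exact h τ hτ (Ne.symm hne)

/-- The mean value inequality bounds the divided difference by the same bound on the derivative that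
controls the diagonal. -/
theorem exists_abs_rhoN_le (n : ℕ) (R : ℝ) :
    ∃ C : ℝ, 0 ≤ C ∧ ∀ s t : ℝ, |s| ≤ R → |t| ≤ R → |rhoN n s t| ≤ C := by
  have hbd : ∀ p : Polynomial ℝ, ∃ C : ℝ, 0 ≤ C ∧ ∀ s : ℝ, |s| ≤ R → |p.eval s| ≤ C := by
    intro p
    obtain ⟨C, hC⟩ := (isCompact_Icc (a := -R) (b := R)).exists_bound_of_continuousOn
      p.continuous.continuousOn
    exact ⟨max C 0, le_max_right _ _, fun s hs => (hC s (abs_le.1 hs)).trans (le_max_left _ _)⟩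
  obtain ⟨A, hA0, hA⟩ := hbd (Q n)
  obtain ⟨B, hB0, hB⟩ := hbd (Q (n + 1))
  obtain ⟨A', hA0', hA'⟩ := hbd (Polynomial.derivative (Q n))
  obtain ⟨B', hB0', hB'⟩ := hbd (Polynomial.derivative (Q (n + 1)))
  refine ⟨(A * B' + B * A') / |h n|, by positivity, fun s t hs ht => ?_⟩
  have hder : ∀ x, |x| ≤ R → |(Q n).eval s * (Polynomial.derivative (Q (n + 1))).eval x -
      (Q (n + 1)).eval s * (Polynomial.derivative (Q n)).eval x| ≤ A * B' + B * A' := by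
    intro x hx
    refine (abs_sub _ _).trans ?_
    rw [abs_mul, abs_mul]
    gcongr
    exacts [hA s hs, hB' x hx, hB s hs, hA' x hx]
  rw [rhoN]
  split_ifs with hst
  · rw [abs_div]
    gcongr
    exact hder s hs
  · have hmv := (convex_Icc (-R) R).norm_image_sub_le_of_norm_hasDerivWithin_le
      (f := fun x => (Q n).eval s * (Q (n + 1)).eval x - (Q (n + 1)).eval s * (Q n).eval x)
      (fun x _ => ((((Q (n + 1)).hasDerivAt x).const_mul _).sub
        (((Q n).hasDerivAt x).const_mul _)).hasDerivWithinAt)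
      (fun x hx => hder x (abs_le.2 hx)) (abs_le.1 hs) (abs_le.1 ht)
    rw [Real.norm_eq_abs, Real.norm_eq_abs] at hmv
    have hts : 0 < |t - s| := abs_pos.2 (sub_ne_zero.2 (Ne.symm hst))
    rw [mul_comm (h n), ← div_div, abs_div, abs_div]
    gcongr
    rw [div_le_iff₀ hts]
    refine le_trans (le_of_eq ?_) hmv
    congr 1
    ring

theorem f_nonneg (s : ℝ) : 0 ≤ f s := by
  unfold f; positivity

theorem f_le_one (s : ℝ) : f s ≤ 1 := by
  refine mul_le_one₀ two_pi_rpow_le_one (Real.exp_pos _).le (Real.exp_le_one_iff.2 ?_)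
  nlinarith [sq_nonneg s]

theorem exists_kernelError_le {ε : ℝ} (hε : 0 < ε) (n : ℕ) :
    ∃ C : ℝ, 0 ≤ C ∧ ∀ x₀ ∈ Set.Icc ε (1 - ε), ∀ σ τ : ℝ, |kernelError n x₀ σ τ| ≤ C := by
  obtain ⟨C, hC0, hC⟩ := exists_abs_rhoN_le n (2 * √((n : ℝ) + 3 / 2))
  refine ⟨2 * √((n : ℝ) + 3 / 2) * C * 1 + 1 * (1 / (2 * Real.pi) ^ 2 * (1 / ε ^ 2)),
    by positivity, fun x₀ hx σ τ => ?_⟩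
  have hr : ∀ ρ, |rescaledPoint x₀ ρ n| ≤ 2 * √((n : ℝ) + 3 / 2) := by
    intro ρ
    rw [rescaledPoint, abs_mul, abs_of_nonneg (by positivity)]
    exact mul_le_of_le_one_right (by positivity) (Real.abs_cos_le_one _)
  have hff : √(f (rescaledPoint x₀ σ n) * f (rescaledPoint x₀ τ n)) ≤ 1 :=
    Real.sqrt_le_one.2 (mul_le_one₀ (f_le_one _) (f_nonneg _) (f_le_one _))
  have hrho : |rho x₀| ≤ 1 / (2 * Real.pi) ^ 2 * (1 / ε ^ 2) := by
    have h1 : √(1 - x₀ ^ 2) ≤ 1 := Real.sqrt_le_one.2 (by linarith [sq_nonneg x₀])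
    rw [rho, abs_of_nonneg (by positivity)]
    gcongr
    exact hx.1
  refine (abs_sub _ _).trans ?_
  rw [abs_mul, abs_mul, abs_mul (Real.sinc _), abs_of_nonneg (Real.sqrt_nonneg (f _ * f _)),
    abs_of_nonneg (by positivity : 0 ≤ 2 * √((n : ℝ) + 3 / 2))]
  gcongr
  · exact hC _ _ (hr σ) (hr τ)
  · exact Real.abs_sinc_le_one _

theorem exists_kernelError_le_rpow {ε : ℝ} (hε : 0 < ε) (M : ℝ) :
    ∃ C : ℝ, ∀ n : ℕ, 1 ≤ n → ∀ x₀ ∈ Set.Icc ε (1 - ε), ∀ σ τ : ℝ, |σ| ≤ M → |τ| ≤ M →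
      |kernelError n x₀ σ τ| ≤ C * (n : ℝ) ^ (-(1 / 2) : ℝ) := by
  obtain ⟨C, hC⟩ := exists_eventually_kernelError_le hε (M + 1)
  obtain ⟨n₀, hn₀⟩ := eventually_atTop.1 hC
  choose D hD0 hD using fun n => exists_kernelError_le hε n
  have hsum : 0 ≤ ∑ k ∈ Finset.range n₀, D k * (k : ℝ) ^ (1 / 2 : ℝ) :=
    Finset.sum_nonneg fun k _ => mul_nonneg (hD0 k) (by positivity)
  -- The sum takes care of the finitely many $n<n_0$ with the crude bounds $D_n$; for the others
  -- $1/n\le n^{-1/2}$.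
  refine ⟨|C| + ∑ k ∈ Finset.range n₀, D k * (k : ℝ) ^ (1 / 2 : ℝ),
    fun n hn x₀ hx σ τ hσ hτ => ?_⟩
  have hn0 : (0 : ℝ) < n := by exact_mod_cast hn
  have hpow : (0 : ℝ) < (n : ℝ) ^ (-(1 / 2) : ℝ) := by positivity
  rcases lt_or_ge n n₀ with hlt | hge
  · have h1 : D n * (n : ℝ) ^ (1 / 2 : ℝ) ≤ ∑ k ∈ Finset.range n₀, D k * (k : ℝ) ^ (1 / 2 : ℝ) :=
      Finset.single_le_sum (f := fun k : ℕ => D k * (k : ℝ) ^ (1 / 2 : ℝ))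
        (fun k _ => mul_nonneg (hD0 k) (by positivity)) (Finset.mem_range.2 hlt)
    calc _ ≤ D n := hD n x₀ hx σ τ
      _ = D n * (n : ℝ) ^ (1 / 2 : ℝ) * (n : ℝ) ^ (-(1 / 2) : ℝ) := by
        rw [mul_assoc, ← Real.rpow_add hn0]; simp
      _ ≤ _ := by
        gcongr
        linarith [abs_nonneg C]
  · have hinv : C * (1 / n) ≤ |C| * (n : ℝ) ^ (-(1 / 2) : ℝ) := by
      have h2 : (1 / n : ℝ) ≤ (n : ℝ) ^ (-(1 / 2) : ℝ) := by
        rw [one_div, ← Real.rpow_neg_one]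
        exact Real.rpow_le_rpow_of_exponent_le (by exact_mod_cast hn) (by norm_num)
      calc C * (1 / n) ≤ |C| * (1 / n) := by gcongr; exact le_abs_self C
        _ ≤ _ := by gcongr
    have h3 : |kernelError n x₀ σ τ| ≤ C * (1 / n) := by
      by_cases hst : σ = τ
      · subst hst
        exact kernelError_self_le hσ fun τ hτ' hne =>
          hn₀ n hge x₀ hx σ τ (by linarith) hτ' hne
      · exact hn₀ n hge x₀ hx σ τ (by linarith) (by linarith) hst
    calc _ ≤ _ := h3.trans hinv
      _ ≤ _ := by
        gcongr
        linarith

end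
end QuatField

theorem mainTheorem6 (ε : ℝ) (hε : 0 < ε) (M : ℝ) :
    ∃ C : ℝ, ∀ n : ℕ, 1 ≤ n → ∀ x₀ ∈ Set.Icc ε (1 - ε), ∀ σ τ : ℝ, |σ| ≤ M → |τ| ≤ M →
      |2 * √((n : ℝ) + 3 / 2)
          * QuatField.rhoN n (QuatField.rescaledPoint x₀ σ n) (QuatField.rescaledPoint x₀ τ n)
          * √(QuatField.f (QuatField.rescaledPoint x₀ σ n)
              * QuatField.f (QuatField.rescaledPoint x₀ τ n))
        - Real.sinc (τ - σ) * QuatField.rho x₀|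
      ≤ C * (n : ℝ) ^ (-(1 / 2) : ℝ) :=
  QuatField.exists_kernelError_le_rpow hε M
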